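/- Let $V$ be a finite set of $n$ spins with local Hilbert space $\mathbb C^q$, so that the system has Hilbert space $(\mathbb C^q)^{\otimes V}$, and let $\mathsf d$ be a metric on $V$. Suppose that there are $A>0$, $d\ge 1$ and $r_0>0$ such that $|\{w\in V:\mathsf d(v,w)\le r\}|\le A\,r^d$ for every $v\in V$ and every $r\ge r_0$. Let $\omega$ be a quantum state of the system, write $\langle X\rangle=\operatorname{Tr}[\omega X]$, and suppose that $\omega$ has correlation length $\xi>0$ with constant $C>0$: for any two disjoint nonempty regions $\Lambda_1,\Lambda_2\subset V$ and any self-adjoint operators $h_1,h_2$ acting only on $\Lambda_1$ and $\Lambda_2$, respectively, $$|\langle h_1h_2\rangle-\langle h_1\rangle\langle h_2\rangle|\le C\,\|h_1\|\,\|h_2\|\,e^{-\mathsf d(\Lambda_1,\Lambda_2)/\xi},\qquad \mathsf d(\Lambda_1,\Lambda_2)=\min_{x_1\in\Lambda_1,\,x_2\in\Lambda_2}\mathsf d(x_1,x_2).$$ Let $H$ be a $k$-local self-adjoint operator (a sum of operators acting on at most $k$ spins each), with local norm $$\|H\|_{\mathrm{loc}}=2\min\Big\{\max_{x\in V}\sum_{\Lambda\ni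 x}\|h_\Lambda\| \;:\; H=\sum_{\Lambda\subseteq V,\ |\Lambda|\le k}h_\Lambda,\ h_\Lambda \text{ self-adjoint and acting only on }\Lambda\Big\}>0,$$ where $\|\cdot\|$ is the operator norm. For $x>0$ let $F(x)=\max_{s>0}s\,(x-e^s+1+\tfrac s2)$ and let $s^*(x)>0$ be the unique maximizer. Let $a>0$, $x=ak/\|H\|_{\mathrm{loc}}$, and $$D=\frac{\xi}{kA^2}\big(k\,s^*(x)+F(x)\big),\qquad l=(nD)^{\frac1{2d+1}}.$$ Let $\mathbb P(H\ge c)$ denote the probability that a measurement of $H$ on $\omega$ gives an outcome in $[c,\infty)$. If $l\ge r_0$, then $$\mathbb P\big(H\ge\langle H\rangle+na\big)\le(C+1)\exp\left[-n^{\frac1{2d+1}}\,\frac{F(x)}{k^2A^2\,D^{\frac{2d}{2d+1}}}\right].$$ If instead $l<r_0$ (small $n$), then $$\mathbb P\big(H\ge\langle H\rangle+na\big)\le(C+1)\exp\left[-n\,\frac{F(x)}{k^2A^2\,r_0^{2d}}\right].$$ -/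

import Mathlib

open scoped Matrix.Norms.L2Operator ComplexOrder

noncomputable section

namespace SpinSystem

section Operators

variable {V : Type*} [Fintype V] [DecidableEq V] {q : ℕ}

/-- Linear operators on `(ℂ^q)^{⊗ V}`, as matrices in the computational basis `V → Fin q`.
The norm `‖·‖` on them is the operator norm of the Euclidean (`ℓ²`) norm. -/
abbrev Op (V : Type*) (q : ℕ) : Type _ := Matrix (V → Fin q) (V → Fin q) ℂ

/-- The operator `B ⊗ 𝕀` on the whole system, for `B` acting on the spins in `Λ`. -/
def embed (Λ : Finset V) (B : Matrix (Λ → Fin q) (Λ → Fin q) ℂ) : Op V q :=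
  Matrix.of fun x y =>
    if ∀ v, v ∉ Λ → x v = y v then B (fun v => x v) (fun v => y v) else 0

/-- `X` acts only on the spins in `Λ`. -/
def ActsOn (Λ : Finset V) (X : Op V q) : Prop :=
  ∃ B : Matrix (Λ → Fin q) (Λ → Fin q) ℂ, X = embed Λ B

/-- `X` is a sum of linear operators each acting on at most `k` spins. -/
def IsKLocal (k : ℕ) (X : Op V q) : Prop :=
  ∃ Y : Finset V → Op V q, (∀ Λ, ActsOn Λ (Y Λ)) ∧ X = ∑ Λ with Λ.card ≤ k, Y Λ

/-- `h` is a decomposition `H = ∑_{|Λ| ≤ k} h_Λ` into observables `h_Λ` acting on `Λ`. -/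
structure IsDecomposition (k : ℕ) (H : Op V q) (h : Finset V → Op V q) : Prop where
  isHermitian : ∀ Λ, (h Λ).IsHermitian
  actsOn : ∀ Λ, ActsOn Λ (h Λ)
  sum_eq : H = ∑ Λ with Λ.card ≤ k, h Λ

/-- The largest dependence on a spin, `2 max_x ∑_{Λ ∋ x, |Λ| ≤ k} ‖h_Λ‖`. -/
def dependence (k : ℕ) (h : Finset V → Op V q) : ℝ :=
  2 * ⨆ x : V, ∑ Λ with x ∈ Λ ∧ Λ.card ≤ k, ‖h Λ‖

/-- The local norm of `H`: the minimum of the dependence over all decompositions of `H` into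
observables acting on at most `k` spins each. For `k = |V|` all decompositions are allowed. -/
def localNorm (k : ℕ) (H : Op V q) : ℝ :=
  sInf {b | ∃ h : Finset V → Op V q, IsDecomposition k H h ∧ b = dependence k h}

/-- Density operators. -/
def IsState (ω : Op V q) : Prop := ω.PosSemidef ∧ ω.trace = 1

/-- The expectation `⟨X⟩ = Tr[ω X]`. -/
def expect (ω X : Op V q) : ℂ := (ω * X).trace

/-- The spectral projection of `H` onto the eigenvalues in `[c, ∞)`. -/
def spectralProj {H : Op V q} (hH : H.IsHermitian) (c : ℝ) : Op V q :=
  (hH.eigenvectorUnitary : Op V q) *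
    Matrix.diagonal (fun i => if c ≤ hH.eigenvalues i then (1 : ℂ) else 0) *
    star (hH.eigenvectorUnitary : Op V q)

/-- The probability that measuring `H` on `ω` gives an outcome in `[c, ∞)` (Born rule). -/
def probGE (ω : Op V q) {H : Op V q} (hH : H.IsHermitian) (c : ℝ) : ℝ :=
  (expect ω (spectralProj hH c)).re

end Operators

section Geometry

variable {V : Type*} [MetricSpace V]

/-- The distance `min {d(x₁, x₂) : x₁ ∈ Λ₁, x₂ ∈ Λ₂}` of two (nonempty) regions. -/
def regionDist (Λ₁ Λ₂ : Finset V) : ℝ :=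
  sInf {r | ∃ x₁ ∈ Λ₁, ∃ x₂ ∈ Λ₂, r = dist x₁ x₂}

/-- The balls of radius `r ≥ r₀` contain at most `A r^d` spins. -/
def BallGrowth (V : Type*) [MetricSpace V] (A d r₀ : ℝ) : Prop :=
  ∀ (v : V) (r : ℝ), r₀ ≤ r → ((Metric.closedBall v r).ncard : ℝ) ≤ A * r ^ d

/-- `ω` has correlation length `ξ`, with constant `C`. -/
def HasCorrelationLength [Fintype V] [DecidableEq V] {q : ℕ} (ω : Op V q) (ξ C : ℝ) : Prop :=
  ∀ Λ₁ Λ₂ : Finset V, Λ₁.Nonempty → Λ₂.Nonempty → Disjoint Λ₁ Λ₂ →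
    ∀ h₁ h₂ : Op V q, h₁.IsHermitian → ActsOn Λ₁ h₁ → h₂.IsHermitian → ActsOn Λ₂ h₂ →
      ‖expect ω (h₁ * h₂) - expect ω h₁ * expect ω h₂‖ ≤
        C * ‖h₁‖ * ‖h₂‖ * Real.exp (-(regionDist Λ₁ Λ₂ / ξ))

end Geometry

section Rate

/-- The function `s (x - e^s + 1 + s/2)`. -/
def rateAux (x s : ℝ) : ℝ := s * (x - Real.exp s + 1 + s / 2)

/-- `F(x) = max_{s > 0} s (x - e^s + 1 + s/2)`. -/
def rateF (x : ℝ) : ℝ := sSup (rateAux x '' Set.Ioi 0)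

/-- `s*(x) = argmax_{s > 0} s (x - e^s + 1 + s/2)`; for `x > 0` the maximizer exists and is
unique, see `isMaxOn_sStar` and `eq_sStar`. -/
def sStar (x : ℝ) : ℝ := sSup {s | 0 < s ∧ IsMaxOn (rateAux x) (Set.Ioi 0) s}

theorem exists_unique_max {x : ℝ} (hx : 0 < x) :
    ∃ s, 0 < s ∧ ∀ t, 0 < t → t ≠ s → rateAux x t < rateAux x s := by
  have hd : ∀ s, HasDerivAt (rateAux x) (x - (Real.exp s - 1) * (s + 1)) s := by
    intro s
    have h1 : HasDerivAt (fun s : ℝ => x - Real.exp s + 1 + s / 2) (-Real.exp s + 1 / 2) s := by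
      have := (((Real.hasDerivAt_exp s).const_sub x).add_const 1).add
        ((hasDerivAt_id s).div_const 2)
      exact this
    have := (hasDerivAt_id s).mul h1
    refine this.congr_deriv ?_
    simp only [id]
    ring
  have hcont : Continuous (rateAux x) :=
    continuous_iff_continuousAt.2 fun s => (hd s).continuousAt
  have hmono : ∀ s t, 0 ≤ s → s < t →
      (Real.exp s - 1) * (s + 1) < (Real.exp t - 1) * (t + 1) := by
    intro s t hs hst
    have h1 : Real.exp s < Real.exp t := Real.exp_lt_exp.2 hst
    have h2 : 1 ≤ Real.exp s := Real.one_le_exp hs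
    nlinarith
  obtain ⟨s, ⟨hs0, -⟩, hsx⟩ : ∃ s ∈ Set.Icc (0 : ℝ) x, (Real.exp s - 1) * (s + 1) = x := by
    have hc : ContinuousOn (fun s : ℝ => (Real.exp s - 1) * (s + 1)) (Set.Icc 0 x) := by fun_prop
    apply intermediate_value_Icc hx.le hc
    constructor
    · simp [hx.le]
    · have := Real.add_one_le_exp x
      nlinarith
  have hs : 0 < s := by
    rcases hs0.eq_or_lt with h | h
    · subst h; simp at hsx; linarith
    · exact h
  refine ⟨s, hs, fun t ht hts => ?_⟩
  rcases lt_or_gt_of_ne hts with h | h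
  · have : StrictMonoOn (rateAux x) (Set.Icc 0 s) := by
      apply strictMonoOn_of_deriv_pos (convex_Icc 0 s) hcont.continuousOn
      intro u hu
      rw [interior_Icc] at hu
      rw [(hd u).deriv]
      have := hmono u s hu.1.le hu.2
      linarith
    exact this ⟨ht.le, h.le⟩ ⟨hs.le, le_rfl⟩ h
  · have : StrictAntiOn (rateAux x) (Set.Ici s) := by
      apply strictAntiOn_of_deriv_neg (convex_Ici s) hcont.continuousOn
      intro u hu
      rw [interior_Ici] at hu
      rw [(hd u).deriv]
      have := hmono s u hs.le hu
      linarith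
    exact this (Set.self_mem_Ici) h.le h

theorem sStar_spec {x : ℝ} (hx : 0 < x) :
    0 < sStar x ∧ ∀ t, 0 < t → t ≠ sStar x → rateAux x t < rateAux x (sStar x) := by
  obtain ⟨s, hs, hmax⟩ := exists_unique_max hx
  have hset : {s | 0 < s ∧ IsMaxOn (rateAux x) (Set.Ioi 0) s} = {s} := by
    ext t
    constructor
    · rintro ⟨ht, htm⟩
      by_contra hne
      exact absurd (hmax t ht hne) (not_lt.2 (htm hs))
    · rintro rfl
      refine ⟨hs, fun u hu => ?_⟩
      rcases eq_or_ne u t with rfl | hne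
      · exact le_refl (rateAux x u)
      · exact (hmax u hu hne).le
  have : sStar x = s := by rw [sStar, hset, csSup_singleton]
  rw [this]
  exact ⟨hs, hmax⟩

theorem isMaxOn_sStar {x : ℝ} (hx : 0 < x) :
    0 < sStar x ∧ IsMaxOn (rateAux x) (Set.Ioi 0) (sStar x) := by
  refine ⟨(sStar_spec hx).1, fun u hu => ?_⟩
  rcases eq_or_ne u (sStar x) with h | hne
  · subst h
    exact le_refl (rateAux x (sStar x))
  · exact ((sStar_spec hx).2 u hu hne).le

theorem eq_sStar {x s : ℝ} (hx : 0 < x) (hs : 0 < s)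
    (hmax : IsMaxOn (rateAux x) (Set.Ioi 0) s) : s = sStar x := by
  by_contra hne
  exact absurd ((sStar_spec hx).2 s hs hne) (not_lt.2 (hmax (sStar_spec hx).1))

theorem rateF_eq {x : ℝ} (hx : 0 < x) : rateF x = rateAux x (sStar x) := by
  have h := isMaxOn_sStar hx
  refine IsGreatest.csSup_eq ⟨⟨_, h.1, rfl⟩, ?_⟩
  rintro _ ⟨u, hu, rfl⟩
  exact h.2 hu

end Rate

end SpinSystem

end

/-!
Write `H - ⟨H⟩` as a sum of centered local terms and expand `⟨(H - ⟨H⟩)^r⟩` into words of length `r`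
in these terms. If one letter of a word is at distance more than `l` from all the others, it
commutes with them and has expectation zero, so the decay of correlations bounds the word by
`C exp(-l/ξ)` times the product of the norms. In the remaining words every letter lies within
distance `l` of another one, so the proximity graph of the word contains a spanning forest of
nontrivial stars. Once the center of a star is chosen, the ball growth and the local norm bound the
weight of each leaf, so that these words contribute at most the exponential of a multiple of the
exponential generating function `u (exp u - 1 - u / 2)` of labelled stars. The exponential Markov
inequality turns these moment bounds into a tail bound, with `F` the Legendre transform of the star
series, and `l` is chosen such that the correlation error is no larger than the star term.
-/

noncomputable section

namespace SpinSystem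

section GeneratingFunctions

open Finset Nat

theorem le_mul_exp_sub_of_hasDerivAt_le {P P' G g : ℝ → ℝ} {a t : ℝ}
    (hP : ∀ u, a ≤ u → HasDerivAt P (P' u) u) (hG : ∀ u, a ≤ u → HasDerivAt G (g u) u)
    (hle : ∀ u, a ≤ u → P' u ≤ g u * P u) (hat : a ≤ t) :
    P t ≤ P a * Real.exp (G t - G a) := by
  have hderiv (u : ℝ) (hu : a ≤ u) : HasDerivAt (fun v => P v * Real.exp (-G v))
      ((P' u - g u * P u) * Real.exp (-G u)) u :=
    ((hP u hu).mul (hG u hu).fun_neg.exp).congr_deriv (by ring)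
  have hanti : AntitoneOn (fun v => P v * Real.exp (-G v)) (Set.Ici a) := by
    refine antitoneOn_of_hasDerivWithinAt_nonpos (convex_Ici a)
      (fun u hu => (hderiv u hu).continuousAt.continuousWithinAt)
      (fun u hu => (hderiv u (interior_subset hu)).hasDerivWithinAt) fun u hu => ?_
    exact mul_nonpos_of_nonpos_of_nonneg (sub_nonpos.2 (hle u (interior_subset hu)))
      (Real.exp_pos _).le
  calc P t = P t * Real.exp (-G t) * Real.exp (G t) := by
        rw [mul_assoc, ← Real.exp_add, neg_add_cancel, Real.exp_zero, mul_one]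
    _ ≤ P a * Real.exp (-G a) * Real.exp (G t) :=
        mul_le_mul_of_nonneg_right (hanti Set.self_mem_Ici hat hat) (Real.exp_pos _).le
    _ = P a * Real.exp (G t - G a) := by
        rw [mul_assoc, ← Real.exp_add, neg_add_eq_sub]

/-- The partial sum `∑_{r < R} N_r t^r / r!` of the exponential generating function of `N`. -/
def egfSum (N : ℕ → ℝ) (R : ℕ) (t : ℝ) : ℝ :=
  ∑ r ∈ range R, N r * t ^ r / r !

variable {a b N : ℕ → ℝ} {R : ℕ} {t : ℝ}

theorem egfSum_mono (hab : ∀ r, a r ≤ b r) (ht : 0 ≤ t) : egfSum a R t ≤ egfSum b R t := by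
  unfold egfSum
  gcongr
  exact hab _

theorem egfSum_nonneg (hN : ∀ r, 0 ≤ N r) (ht : 0 ≤ t) : 0 ≤ egfSum N R t :=
  sum_nonneg fun r _ => by have := hN r; positivity

theorem egfSum_succ_zero : egfSum N (R + 1) 0 = N 0 := by
  simp [egfSum, sum_range_succ']

theorem egfSum_le_egfSum_succ (hN : ∀ r, 0 ≤ N r) (ht : 0 ≤ t) :
    egfSum N R t ≤ egfSum N (R + 1) t := by
  rw [egfSum, egfSum, sum_range_succ]
  have := hN R
  exact le_add_of_nonneg_right (by positivity)

theorem hasDerivAt_egfSum (N : ℕ → ℝ) (R : ℕ) (t : ℝ) :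
    HasDerivAt (egfSum N (R + 1)) (egfSum (fun r => N (r + 1)) R t) t := by
  have hterm (r : ℕ) : HasDerivAt (fun u : ℝ => N (r + 1) * u ^ (r + 1) / (r + 1)!)
      (N (r + 1) * t ^ r / r !) t := by
    refine (((hasDerivAt_pow (r + 1) t).const_mul (N (r + 1))).div_const _).congr_deriv ?_
    rw [factorial_succ, add_tsub_cancel_right]
    push_cast
    field_simp
  have hsum : egfSum N (R + 1) =
      fun u => (∑ r ∈ range R, N (r + 1) * u ^ (r + 1) / (r + 1)!) + N 0 := by
    ext u
    simp [egfSum, sum_range_succ']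
  rw [hsum]
  exact (HasDerivAt.fun_sum fun r _ => hterm r).add_const _

theorem egfSum_binomial_convolution_le (ha : ∀ r, 0 ≤ a r) (hb : ∀ r, 0 ≤ b r) (ht : 0 ≤ t) :
    egfSum (fun r => ∑ m ∈ range (r + 1), r.choose m * (a m * b (r - m))) R t ≤
      egfSum a R t * egfSum b R t := by
  have hconv (r : ℕ) : (∑ m ∈ range (r + 1), r.choose m * (a m * b (r - m))) * t ^ r / r ! =
      ∑ m ∈ range (r + 1), a m * t ^ m / m ! * (b (r - m) * t ^ (r - m) / (r - m)!) := by
    rw [sum_mul, sum_div]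
    refine sum_congr rfl fun m hm => ?_
    have hmr : m ≤ r := mem_range_succ_iff.1 hm
    rw [cast_choose ℝ hmr, ← pow_mul_pow_sub t hmr]
    field_simp
  calc egfSum (fun r => ∑ m ∈ range (r + 1), r.choose m * (a m * b (r - m))) R t
      = ∑ m ∈ range R, ∑ j ∈ range (R - m), a m * t ^ m / m ! * (b j * t ^ j / j !) := by
        simp only [egfSum, hconv]
        exact sum_range_diag_flip R fun m j => a m * t ^ m / m ! * (b j * t ^ j / j !)
    _ ≤ ∑ m ∈ range R, ∑ j ∈ range R, a m * t ^ m / m ! * (b j * t ^ j / j !) := by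
        refine sum_le_sum fun m _ => sum_le_sum_of_subset_of_nonneg ?_ fun j _ _ => ?_
        · exact range_subset_range.2 (Nat.sub_le R m)
        · have := ha m
          have := hb j
          positivity
    _ = egfSum a R t * egfSum b R t := (sum_mul_sum ..).symm

/-- The upper-bound half of the exponential formula: the hypotheses say that the generating
functions satisfy `N' ≤ a N` and `a ≤ g = G'`. -/
theorem egfSum_le_exp {G g : ℝ → ℝ} (ha : ∀ r, 0 ≤ a r) (hN : ∀ r, 0 ≤ N r) (hN₀ : N 0 ≤ 1)
    (hrec : ∀ r, N (r + 1) ≤ ∑ m ∈ range (r + 1), r.choose m * (a m * N (r - m)))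
    (hG : ∀ u, 0 ≤ u → HasDerivAt G (g u) u) (hG₀ : G 0 = 0)
    (hag : ∀ R u, 0 ≤ u → egfSum a R u ≤ g u) (ht : 0 ≤ t) :
    egfSum N R t ≤ Real.exp (G t) := by
  have hle (u : ℝ) (hu : 0 ≤ u) :
      egfSum (fun r => N (r + 1)) R u ≤ g u * egfSum N (R + 1) u :=
    calc egfSum (fun r => N (r + 1)) R u
        ≤ egfSum a R u * egfSum N R u :=
          (egfSum_mono hrec hu).trans (egfSum_binomial_convolution_le ha hN hu)
      _ ≤ g u * egfSum N (R + 1) u :=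
          mul_le_mul (hag R u hu) (egfSum_le_egfSum_succ hN hu) (egfSum_nonneg hN hu)
            ((egfSum_nonneg ha hu).trans (hag R u hu))
  calc egfSum N R t ≤ egfSum N (R + 1) t := egfSum_le_egfSum_succ hN ht
    _ ≤ egfSum N (R + 1) 0 * Real.exp (G t - G 0) :=
        le_mul_exp_sub_of_hasDerivAt_le (fun u _ => hasDerivAt_egfSum N R u) hG hle ht
    _ ≤ Real.exp (G t) := by
        rw [egfSum_succ_zero, hG₀, sub_zero]
        exact mul_le_of_le_one_left (Real.exp_pos _).le hN₀

end GeneratingFunctions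

section Stars

open Finset Nat

/-- The number of stars on `m + 1` labelled vertices which use all vertices. A single vertex is not
counted as a star, and the two ends of a single edge give the same star. -/
def starCount : ℕ → ℕ
  | 0 => 0
  | 1 => 1
  | m + 2 => m + 3

/-- The exponential generating function of labelled stars. -/
def starSeries (u : ℝ) : ℝ :=
  u * (Real.exp u - 1 - u / 2)

theorem starSeries_zero : starSeries 0 = 0 :=
  zero_mul _

theorem hasDerivAt_starSeries (u : ℝ) :
    HasDerivAt starSeries ((Real.exp u - 1) * (1 + u)) u :=
  ((hasDerivAt_id u).fun_mul (((Real.hasDerivAt_exp u).sub_const 1).fun_sub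
    ((hasDerivAt_id u).div_const 2))).congr_deriv (by simp only [id]; ring)

theorem starSeries_mul_le {u c : ℝ} (hu : 0 ≤ u) (hc₀ : 0 ≤ c) (hc₁ : c ≤ 1) :
    starSeries (c * u) ≤ c * starSeries u := by
  have hconvex : Real.exp (c * u) ≤ c * Real.exp u + (1 - c) := by
    simpa using convexOn_exp.2 (Set.mem_univ u) (Set.mem_univ 0) hc₀ (sub_nonneg.2 hc₁) (by ring)
  have hexp : u + 1 ≤ Real.exp u := Real.add_one_le_exp u
  rw [starSeries, starSeries, mul_assoc c u]
  refine mul_le_mul_of_nonneg_left (mul_le_mul_of_nonneg_left ?_ hu) hc₀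
  nlinarith

theorem egfSum_starCount_le (R : ℕ) {u : ℝ} (hu : 0 ≤ u) :
    egfSum (fun m => (starCount m : ℝ)) R u ≤ (Real.exp u - 1) * (1 + u) := by
  have hsum (S : ℕ) : egfSum (fun m => (starCount m : ℝ)) (S + 2) u =
      (∑ m ∈ range (S + 2), u ^ m / (m ! : ℝ) - 1) +
        u * (∑ m ∈ range (S + 1), u ^ m / (m ! : ℝ) - 1) := by
    simp only [egfSum]
    induction S with
    | zero => simp [starCount, sum_range_succ]
    | succ S ih =>
      rw [sum_range_succ, ih, sum_range_succ _ (S + 2), sum_range_succ _ (S + 1), starCount,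
        factorial_succ (S + 1)]
      push_cast
      field_simp
      ring
  have hnonneg (m : ℕ) : (0 : ℝ) ≤ starCount m := cast_nonneg _
  calc egfSum (fun m => (starCount m : ℝ)) R u
      ≤ egfSum (fun m => (starCount m : ℝ)) (R + 2) u :=
        (egfSum_le_egfSum_succ hnonneg hu).trans (egfSum_le_egfSum_succ hnonneg hu)
    _ ≤ (Real.exp u - 1) + u * (Real.exp u - 1) := by
        rw [hsum]
        gcongr <;> exact Real.sum_le_exp_of_nonneg hu _
    _ = (Real.exp u - 1) * (1 + u) := by ring

end Stars

section Peeling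

open Finset

variable {γ : Type*} [DecidableEq γ] {r : γ → γ → Prop}

/-- The vertices which can serve as the center of a star with vertex set `insert o t`; for a single
edge only `o` is chosen. -/
def starCenters (o : γ) (t : Finset γ) : Finset γ :=
  if t = ∅ then ∅ else if #t = 1 then {o} else insert o t

theorem card_starCenters {o : γ} {t : Finset γ} (ho : o ∉ t) :
    #(starCenters o t) = starCount #t := by
  unfold starCenters
  split_ifs with h₀ h₁
  · simp [h₀, starCount]
  · simp [h₁, starCount]
  · obtain ⟨m, hm⟩ : ∃ m, #t = m + 2 :=
      ⟨#t - 2, by have := card_ne_zero.2 (nonempty_iff_ne_empty.2 h₀); omega⟩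
    rw [card_insert_of_notMem ho, hm, starCount]

theorem starCenters_subset_insert (o : γ) (t : Finset γ) : starCenters o t ⊆ insert o t := by
  unfold starCenters
  split_ifs <;> simp

theorem self_mem_starCenters (o : γ) {t : Finset γ} (ht : t.Nonempty) : o ∈ starCenters o t := by
  unfold starCenters
  rw [if_neg ht.ne_empty]
  split_ifs <;> simp

theorem mem_starCenters_insert (o : γ) {j : γ} {t : Finset γ} (ht : t.Nonempty) (hj : j ∉ t) :
    j ∈ starCenters o (insert j t) := by
  unfold starCenters
  rw [if_neg (insert_ne_empty _ _), if_neg]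
  · simp
  · rw [card_insert_of_notMem hj]
    have := ht.card_pos
    omega

open Classical in
/-- The vertices of the graph `r` which become isolated when the vertices in `s` are removed. -/
def isolatedBy [Fintype γ] (r : γ → γ → Prop) (s : Finset γ) : Finset γ :=
  {v | v ∉ s ∧ ∀ j, j ≠ v → r v j → j ∈ s}

theorem mem_isolatedBy [Fintype γ] {s : Finset γ} {v : γ} :
    v ∈ isolatedBy r s ↔ v ∉ s ∧ ∀ j, j ≠ v → r v j → j ∈ s := by
  simp only [isolatedBy, mem_filter_univ]

theorem exists_adj_of_notMem_union_isolatedBy [Fintype γ] (hr : Std.Symm r) (s : Finset γ)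
    {i : γ} (hi : i ∉ s ∪ isolatedBy r s) : ∃ j ∉ s ∪ isolatedBy r s, j ≠ i ∧ r i j := by
  simp only [mem_union, mem_isolatedBy, not_or, not_and, not_forall] at hi ⊢
  obtain ⟨his, hi⟩ := hi
  obtain ⟨j, hji, hij, hjs⟩ := hi his
  exact ⟨j, ⟨hjs, fun _ => ⟨i, hji.symm, hr.symm _ _ hij, his⟩⟩, hji, hij⟩

/-- In a graph without isolated vertices, a star at `o` can be removed so that no vertex becomes
isolated: take the edges from `o` to the vertices which removing `o` isolates if there are any, and
otherwise do the same for both ends of an edge at `o`. -/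
theorem exists_star [Finite γ] (hr : Std.Symm r) (hiso : ∀ i, ∃ j, j ≠ i ∧ r i j) (o : γ) :
    ∃ t, o ∉ t ∧ ∃ c ∈ starCenters o t, (∀ i ∈ insert o t, i ≠ c → r c i) ∧
      ∀ i ∉ insert o t, ∃ j ∉ insert o t, j ≠ i ∧ r i j := by
  cases nonempty_fintype γ
  have hrest (s : Finset γ) (i) := exists_adj_of_notMem_union_isolatedBy hr s (i := i)
  obtain ⟨j, hjo, hoj⟩ := hiso o
  by_cases hleaf : (isolatedBy r {o}).Nonempty
  · refine ⟨isolatedBy r {o}, by simp [mem_isolatedBy], o, self_mem_starCenters o hleaf,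
      fun i hi hio => ?_, hrest {o}⟩
    obtain ⟨v, hvi, hiv⟩ := hiso i
    have hvo := (mem_isolatedBy.1 ((mem_insert.1 hi).resolve_left hio)).2 v hvi hiv
    exact hr.symm _ _ (mem_singleton.1 hvo ▸ hiv)
  have hadj (i) (hi : i ∈ isolatedBy r {o, j}) : r j i := by
    simp only [mem_isolatedBy, mem_insert, mem_singleton, not_or] at hi
    obtain ⟨v, hvi, hiv, hvo⟩ : ∃ v, v ≠ i ∧ r i v ∧ v ≠ o := by
      by_contra! h
      exact hleaf ⟨i, by simpa [mem_isolatedBy, hi.1.1] using h⟩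
    exact hr.symm _ _ ((hi.2 v hvi hiv).resolve_left hvo ▸ hiv)
  have hj : j ∉ isolatedBy r {o, j} := by simp [mem_isolatedBy]
  refine ⟨insert j (isolatedBy r {o, j}), by simp [mem_isolatedBy, hjo.symm], ?_⟩
  by_cases hcherry : (isolatedBy r {o, j}).Nonempty
  · refine ⟨j, mem_starCenters_insert o hcherry hj, fun i hi hij => ?_,
      by simpa [insert_union] using hrest {o, j}⟩
    rcases mem_insert.1 hi with rfl | hi
    · exact hr.symm _ _ hoj
    · exact hadj i ((mem_insert.1 hi).resolve_left hij)
  · refine ⟨o, self_mem_starCenters o (insert_nonempty _ _), fun i hi hio => ?_,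
      by simpa [insert_union] using hrest {o, j}⟩
    have : i = j := by simpa [not_nonempty_iff_eq_empty.1 hcherry, hio] using hi
    exact this ▸ hoj

end Peeling

section Words

open Finset Nat

theorem sum_filter_le_sum_sum_filter {α β : Type*} [Fintype α] {p : α → Prop} [DecidablePred p]
    {s : Finset β} {Q : β → α → Prop} [∀ b, DecidablePred (Q b)] {W : α → ℝ} (hW : ∀ a, 0 ≤ W a)
    (hcover : ∀ a, p a → ∃ b ∈ s, Q b a) :
    ∑ a with p a, W a ≤ ∑ b ∈ s, ∑ a with Q b a, W a := by
  have hnonneg (a : α) (b : β) : 0 ≤ if Q b a then W a else 0 := by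
    split_ifs <;> simp [hW a]
  simp only [sum_filter]
  rw [sum_comm]
  refine sum_le_sum fun a _ => ?_
  split_ifs with ha
  · obtain ⟨b, hb, hab⟩ := hcover a ha
    calc W a = if Q b a then W a else 0 := (if_pos hab).symm
      _ ≤ _ := single_le_sum (f := fun b => if Q b a then W a else 0) (fun b _ => hnonneg a b) hb
  · exact sum_nonneg fun b _ => hnonneg a b

variable {ι γ δ : Type*} {adj : ι → ι → Prop} {w : ι → ℝ}

/-- Every letter of the word `f` is adjacent to the letter at some other position. -/
def NoIsolated (adj : ι → ι → Prop) (f : γ → ι) : Prop :=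
  ∀ i, ∃ j, j ≠ i ∧ adj (f i) (f j)

theorem noIsolated_comp_equiv (e : γ ≃ δ) (f : δ → ι) :
    NoIsolated adj (f ∘ e) ↔ NoIsolated adj f := by
  refine e.forall_congr fun {i} => e.exists_congr fun {j} => ?_
  simp

variable [Fintype ι] [Fintype γ] [DecidableEq γ]

theorem sum_prod_filter_subtype_and (w : ι → ℝ) (T : Finset γ)
    (P : ({i // i ∈ T} → ι) → Prop) (Q : ({i // i ∉ T} → ι) → Prop)
    [DecidablePred P] [DecidablePred Q] :
    ∑ f : γ → ι with P (fun i => f i) ∧ Q (fun i => f i), ∏ i, w (f i) =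
      (∑ f with P f, ∏ i, w (f i)) * ∑ f with Q f, ∏ i, w (f i) := by
  let e := Equiv.piEquivPiSubtypeProd (· ∈ T) fun _ : γ => ι
  have hprod (f : γ → ι) : ∏ i, w (f i) =
      (∏ i : {i // i ∈ T}, w (f i)) * ∏ i : {i // i ∉ T}, w (f i) := by
    convert (Fintype.prod_subtype_mul_prod_subtype (· ∈ T) fun i => w (f i)).symm
  calc ∑ f : γ → ι with P (fun i => f i) ∧ Q (fun i => f i), ∏ i, w (f i)
      = ∑ f : γ → ι, (if P (e f).1 then ∏ i, w ((e f).1 i) else 0) *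
          if Q (e f).2 then ∏ i, w ((e f).2 i) else 0 := by
        rw [sum_filter]
        refine sum_congr rfl fun f _ => ?_
        rw [ite_zero_mul_ite_zero, hprod]
        rfl
    _ = ∑ g : ({i // i ∈ T} → ι) × ({i // i ∉ T} → ι), (if P g.1 then ∏ i, w (g.1 i) else 0) *
          if Q g.2 then ∏ i, w (g.2 i) else 0 :=
        e.sum_comp fun g => (if P g.1 then ∏ i, w (g.1 i) else 0) *
          if Q g.2 then ∏ i, w (g.2 i) else 0
    _ = (∑ f with P f, ∏ i, w (f i)) * ∑ f with Q f, ∏ i, w (f i) := by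
        rw [Fintype.sum_prod_type, sum_filter, sum_filter, sum_mul_sum]

open Classical in
/-- The weight `∑_a w(a) (∑_{b ∼ a} w(b))^m` of all words forming a star with `m` edges around a
fixed position. -/
def starWeight (adj : ι → ι → Prop) (w : ι → ℝ) (m : ℕ) : ℝ :=
  ∑ a, w a * (∑ b with adj a b, w b) ^ m

theorem starWeight_nonneg (hw : ∀ a, 0 ≤ w a) (m : ℕ) : 0 ≤ starWeight adj w m :=
  sum_nonneg fun a _ => mul_nonneg (hw a) (pow_nonneg (sum_nonneg fun b _ => hw b) m)

open Classical in
theorem sum_prod_star_eq_starWeight (adj : ι → ι → Prop) (w : ι → ℝ) (c : γ) :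
    ∑ f : γ → ι with ∀ i ≠ c, adj (f c) (f i), ∏ i, w (f i) =
      starWeight adj w (Fintype.card γ - 1) := by
  let e := Equiv.funSplitAt c ι
  calc ∑ f : γ → ι with ∀ i ≠ c, adj (f c) (f i), ∏ i, w (f i)
      = ∑ f : γ → ι, if ∀ i, adj (e f).1 ((e f).2 i) then
          w (e f).1 * ∏ i, w ((e f).2 i) else 0 := by
        rw [sum_filter]
        refine sum_congr rfl fun f _ => ?_
        rw [Fintype.prod_eq_mul_prod_subtype_ne _ c]
        exact if_congr (Subtype.forall (p := (· ≠ c)) (q := fun i => adj (f c) (f i))).symm rfl rfl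
    _ = ∑ p : ι × ({i // i ≠ c} → ι), if ∀ i, adj p.1 (p.2 i) then
          w p.1 * ∏ i, w (p.2 i) else 0 :=
        e.sum_comp fun p => if ∀ i, adj p.1 (p.2 i) then w p.1 * ∏ i, w (p.2 i) else 0
    _ = ∑ a, w a * ∑ g ∈ Fintype.piFinset fun _ : {i // i ≠ c} => ({b | adj a b} : Finset ι),
          ∏ i, w (g i) := by
        rw [Fintype.sum_prod_type]
        refine sum_congr rfl fun a _ => ?_
        rw [mul_sum, ← sum_filter]
        refine sum_congr ?_ fun _ _ => rfl
        ext g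
        simp
    _ = starWeight adj w (Fintype.card γ - 1) := by
        refine sum_congr rfl fun a _ => ?_
        rw [← prod_univ_sum, prod_const, Finset.card_univ, Fintype.card_subtype_compl,
          Fintype.card_subtype_eq]

variable (γ) in
open Classical in
/-- The total weight of the words with positions in `γ` in which no letter is isolated. -/
def clusterWeight (adj : ι → ι → Prop) (w : ι → ℝ) : ℝ :=
  ∑ f : γ → ι with NoIsolated adj f, ∏ i, w (f i)

theorem clusterWeight_nonneg (hw : ∀ a, 0 ≤ w a) : 0 ≤ clusterWeight γ adj w :=
  sum_nonneg fun _ _ => prod_nonneg fun _ _ => hw _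

theorem clusterWeight_congr [Fintype δ] [DecidableEq δ] (e : γ ≃ δ) :
    clusterWeight γ adj w = clusterWeight δ adj w := by
  unfold clusterWeight
  rw [sum_filter, sum_filter]
  refine Fintype.sum_equiv (e.arrowCongr (Equiv.refl ι)) _ _ fun f => ?_
  congr 1
  · exact propext (noIsolated_comp_equiv e.symm f).symm
  · exact (e.symm.prod_comp fun i => w (f i)).symm

theorem clusterWeight_of_isEmpty [IsEmpty γ] : clusterWeight γ adj w = 1 := by
  simp [clusterWeight, NoIsolated]

theorem clusterWeight_le_sum_starWeight_mul (hadj : Std.Symm adj) (hw : ∀ a, 0 ≤ w a) (o : γ) :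
    clusterWeight γ adj w ≤ ∑ t ∈ (univ.erase o).powerset,
      (starCount #t * starWeight adj w #t) * clusterWeight {i // i ∉ insert o t} adj w := by
  classical
  let star (T : Finset γ) (c : γ) (f : {i // i ∈ T} → ι) : Prop :=
    ∀ hc : c ∈ T, ∀ i ≠ ⟨c, hc⟩, adj (f ⟨c, hc⟩) (f i)
  have hcover (f : γ → ι) (hf : NoIsolated adj f) :
      ∃ b ∈ (univ.erase o).powerset.sigma (starCenters o),
        star (insert o b.1) b.2 (fun i => f i) ∧
          NoIsolated adj (fun i : {i // i ∉ insert o b.1} => f i) := by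
    obtain ⟨t, hot, c, hc, hstar, hrest⟩ :=
      exists_star (r := fun i j => adj (f i) (f j)) ⟨fun _ _ => hadj.symm _ _⟩ hf o
    refine ⟨⟨t, c⟩, ?_, fun _ i hi => hstar i i.2 (Subtype.coe_ne_coe.2 hi), fun ⟨i, hi⟩ => ?_⟩
    · simp [subset_erase, hot, hc]
    · obtain ⟨j, hj, hji, hij⟩ := hrest i hi
      exact ⟨⟨j, hj⟩, by simpa using hji, hij⟩
  have hstar {t : Finset γ} (ht : t ∈ (univ.erase o).powerset) {c : γ} (hc : c ∈ starCenters o t) :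
      ∑ f with star (insert o t) c f, ∏ i, w (f i) = starWeight adj w #t := by
    have hcard : #t = Fintype.card {i // i ∈ insert o t} - 1 := by
      rw [Fintype.card_coe, card_insert_of_notMem (subset_erase.1 (mem_powerset.1 ht)).2,
        add_tsub_cancel_right]
    rw [hcard, ← sum_prod_star_eq_starWeight adj w ⟨c, starCenters_subset_insert o t hc⟩]
    simp only [star, starCenters_subset_insert o t hc, forall_true_left]
  calc clusterWeight γ adj w
      ≤ _ := sum_filter_le_sum_sum_filter (fun f => prod_nonneg fun i _ => hw (f i)) hcover
    _ = _ := by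
        rw [sum_sigma]
        refine sum_congr rfl fun t ht => ?_
        rw [← card_starCenters (subset_erase.1 (mem_powerset.1 ht)).2, mul_assoc, ← nsmul_eq_mul]
        refine sum_eq_card_nsmul fun c hc => ?_
        rw [sum_prod_filter_subtype_and w (insert o t), hstar ht hc, clusterWeight]

theorem clusterWeight_fin_succ_le (hadj : Std.Symm adj) (hw : ∀ a, 0 ≤ w a) (r : ℕ) :
    clusterWeight (Fin (r + 1)) adj w ≤ ∑ m ∈ range (r + 1), r.choose m *
      ((starCount m * starWeight adj w m) * clusterWeight (Fin (r - m)) adj w) := by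
  have hcard {t : Finset (Fin (r + 1))} (ht : t ∈ (univ.erase 0).powerset) :
      Fintype.card {i // i ∉ insert 0 t} = r - #t := by
    rw [Fintype.card_subtype_compl, Fintype.card_fin, Fintype.card_coe,
      card_insert_of_notMem (subset_erase.1 (mem_powerset.1 ht)).2]
    omega
  calc clusterWeight (Fin (r + 1)) adj w
      ≤ ∑ t ∈ (univ.erase 0).powerset, (starCount #t * starWeight adj w #t) *
          clusterWeight {i // i ∉ insert 0 t} adj w :=
        clusterWeight_le_sum_starWeight_mul hadj hw 0
    _ = ∑ t ∈ (univ.erase (0 : Fin (r + 1))).powerset,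
          (starCount #t * starWeight adj w #t) * clusterWeight (Fin (r - #t)) adj w :=
        sum_congr rfl fun t ht => by
          rw [clusterWeight_congr (Fintype.equivFinOfCardEq (hcard ht))]
    _ = _ := by
        rw [sum_powerset_apply_card (fun m => (starCount m * starWeight adj w m) *
          clusterWeight (Fin (r - m)) adj w), card_erase_of_mem (mem_univ _), Finset.card_univ,
          Fintype.card_fin, add_tsub_cancel_right]
        simp only [nsmul_eq_mul]

theorem egfSum_clusterWeight_le (hadj : Std.Symm adj) (hw : ∀ a, 0 ≤ w a) {W K : ℝ} (hW : 0 ≤ W)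
    (hK : 0 < K) (hstar : ∀ m, m ≠ 0 → starWeight adj w m ≤ W * K ^ m) {t : ℝ} (ht : 0 ≤ t)
    (R : ℕ) :
    egfSum (fun r => clusterWeight (Fin r) adj w) R t ≤ Real.exp (W / K * starSeries (K * t)) := by
  have hG (u : ℝ) : HasDerivAt (fun v => W / K * starSeries (K * v))
      (W * ((Real.exp (K * u) - 1) * (1 + K * u))) u := by
    refine (((hasDerivAt_starSeries (K * u)).comp u ((hasDerivAt_id u).const_mul K)).const_mul
      (W / K)).congr_deriv ?_
    field_simp
  have hcount (m : ℕ) : starCount m * starWeight adj w m ≤ W * (starCount m * K ^ m) := by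
    rcases eq_or_ne m 0 with rfl | hm
    · simp [starCount]
    · rw [mul_left_comm]
      exact mul_le_mul_of_nonneg_left (hstar m hm) (cast_nonneg _)
  refine egfSum_le_exp (fun m => mul_nonneg (cast_nonneg _) (starWeight_nonneg hw m))
    (fun r => clusterWeight_nonneg hw) clusterWeight_of_isEmpty.le
    (clusterWeight_fin_succ_le hadj hw) (fun u _ => hG u) (by simp [starSeries_zero])
    (fun R u hu => ?_) ht
  calc egfSum (fun m => starCount m * starWeight adj w m) R u
      ≤ egfSum (fun m => W * (starCount m * K ^ m)) R u := egfSum_mono hcount hu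
    _ = W * egfSum (fun m => (starCount m : ℝ)) R (K * u) := by
        simp only [egfSum, mul_sum, mul_pow, mul_assoc, mul_div_assoc]
    _ ≤ W * ((Real.exp (K * u) - 1) * (1 + K * u)) :=
        mul_le_mul_of_nonneg_left (egfSum_starCount_le R (by positivity)) hW

end Words

section LocalOperators

open Matrix
open scoped Kronecker

variable {V : Type*} [Fintype V] [DecidableEq V] {q : ℕ} {Λ Λ' : Finset V} {X Y : Op V q}

theorem embed_eq_submatrix (Λ : Finset V) (B : Matrix (Λ → Fin q) (Λ → Fin q) ℂ) :
    embed Λ B = (B ⊗ₖ (1 : Matrix ({v // v ∉ Λ} → Fin q) ({v // v ∉ Λ} → Fin q) ℂ)).submatrix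
      (Equiv.piEquivPiSubtypeProd (· ∈ Λ) fun _ => Fin q)
      (Equiv.piEquivPiSubtypeProd (· ∈ Λ) fun _ => Fin q) := by
  ext x y
  simp [embed, one_apply, funext_iff]

theorem embed_one (Λ : Finset V) : embed Λ (1 : Matrix (Λ → Fin q) (Λ → Fin q) ℂ) = 1 := by
  rw [embed_eq_submatrix, one_kronecker_one, submatrix_one_equiv]

theorem embed_smul (Λ : Finset V) (c : ℂ) (B : Matrix (Λ → Fin q) (Λ → Fin q) ℂ) :
    embed Λ (c • B) = c • embed Λ B := by
  simp only [embed_eq_submatrix, smul_kronecker, submatrix_smul, Pi.smul_apply]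

/-- `embed Λ` as a homomorphism of star algebras. -/
def embedStarAlgHom (q : ℕ) (Λ : Finset V) :
    Matrix (Λ → Fin q) (Λ → Fin q) ℂ →⋆ₐ[ℂ] Op V q where
  toFun := embed Λ
  map_one' := embed_one Λ
  map_mul' B B' := by
    simp only [embed_eq_submatrix, submatrix_mul_equiv, ← mul_kronecker_mul, mul_one]
  map_zero' := by simp only [embed_eq_submatrix, zero_kronecker, submatrix_zero, Pi.zero_apply]
  map_add' B B' := by simp only [embed_eq_submatrix, add_kronecker, submatrix_add, Pi.add_apply]
  commutes' c := by simp only [Algebra.algebraMap_eq_smul_one, embed_smul, embed_one]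
  map_star' B := by
    simp only [star_eq_conjTranspose, embed_eq_submatrix, conjTranspose_submatrix,
      conjTranspose_kronecker, conjTranspose_one]

/-- The star algebra of the operators acting only on `Λ`. -/
def localAlgebra (q : ℕ) (Λ : Finset V) : StarSubalgebra ℂ (Op V q) :=
  (embedStarAlgHom q Λ).range

theorem mem_localAlgebra : X ∈ localAlgebra q Λ ↔ ActsOn Λ X :=
  exists_congr fun _ => eq_comm

theorem ActsOn.mono (h : Λ ⊆ Λ') (hX : ActsOn Λ X) : ActsOn Λ' X := by
  obtain ⟨B, rfl⟩ := hX
  refine ⟨of fun x y => if ∀ v : Λ', (v : V) ∉ Λ → x v = y v then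
    B (fun v => x ⟨v, h v.2⟩) (fun v => y ⟨v, h v.2⟩) else 0, ?_⟩
  ext x y
  simp only [embed, of_apply, ← ite_and]
  refine if_congr ⟨fun H => ⟨fun v hv => H v (mt (@h v) hv), fun v hv => H v hv⟩,
    fun ⟨H, H'⟩ v hv => ?_⟩ rfl rfl
  by_cases hv' : v ∈ Λ'
  · exact H' ⟨v, hv'⟩ hv
  · exact H v hv'

theorem embed_mul_embed_apply (h : Disjoint Λ Λ')
    (B : Matrix (Λ → Fin q) (Λ → Fin q) ℂ) (B' : Matrix (Λ' → Fin q) (Λ' → Fin q) ℂ)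
    (x y : V → Fin q) :
    (embed Λ B * embed Λ' B') x y = if ∀ v, v ∉ Λ → v ∉ Λ' → x v = y v then
      B (fun v => x v) (fun v => y v) * B' (fun v => x v) (fun v => y v) else 0 := by
  let z (v : V) : Fin q := if v ∈ Λ then y v else x v
  have hxz (v) (hv : v ∉ Λ) : x v = z v := (if_neg hv).symm
  have hzy : (∀ v, v ∉ Λ' → z v = y v) ↔ ∀ v, v ∉ Λ → v ∉ Λ' → x v = y v := by
    refine forall_congr' fun v => ?_
    by_cases hv : v ∈ Λ <;> simp [z, hv]
  have hzΛ : (fun v : Λ => z v) = fun v : Λ => y v := funext fun v => if_pos v.2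
  have hzΛ' : (fun v : Λ' => z v) = fun v : Λ' => x v :=
    funext fun v => if_neg (Finset.disjoint_right.1 h v.2)
  rw [mul_apply, Finset.sum_eq_single z]
  · simp only [embed, of_apply, if_pos hxz, hzy, hzΛ, hzΛ', mul_ite, mul_zero]
  · intro z' _ hz'
    simp only [embed, of_apply]
    split_ifs with hxz' hzy'
    · refine absurd (funext fun v => ?_) hz'
      by_cases hv : v ∈ Λ
      · simp only [z, if_pos hv, hzy' v (Finset.disjoint_left.1 h hv)]
      · rw [← hxz' v hv, hxz v hv]
    all_goals simp
  · exact fun hz => absurd (Finset.mem_univ _) hz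

theorem ActsOn.commute (h : Disjoint Λ Λ') (hX : ActsOn Λ X) (hY : ActsOn Λ' Y) :
    Commute X Y := by
  obtain ⟨B, rfl⟩ := hX
  obtain ⟨B', rfl⟩ := hY
  ext x y
  rw [embed_mul_embed_apply h, embed_mul_embed_apply h.symm]
  exact if_congr (forall_congr' fun v => imp.swap) (mul_comm _ _) rfl

theorem ActsOn.exists_eq_smul_one (hX : ActsOn ∅ X) : ∃ c : ℂ, X = c • 1 := by
  obtain ⟨B, rfl⟩ := hX
  have hB : B = B isEmptyElim isEmptyElim • 1 := by
    ext x y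
    rw [Subsingleton.elim x isEmptyElim, Subsingleton.elim y isEmptyElim, Matrix.smul_apply,
      one_apply_eq, smul_eq_mul, mul_one]
  exact ⟨_, by rw [hB, embed_smul, embed_one]⟩

end LocalOperators

section OrderedProducts

variable {R : Type*}

theorem prod_ofFn_eq_mul_of_commute [Monoid R] {r : ℕ} (F : Fin (r + 1) → R) (i : Fin (r + 1))
    (hcomm : ∀ j, Commute (F i) (F j)) :
    (List.ofFn F).prod = F i * (List.ofFn fun j => F (i.succAbove j)).prod := by
  induction r with
  | zero => simp [Fin.fin_one_eq_zero i]
  | succ r ih =>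
    cases i using Fin.cases with
    | zero => simp
    | succ i =>
      calc (List.ofFn F).prod
          = F 0 * (F i.succ * (List.ofFn fun j => F (i.succAbove j).succ).prod) := by
            rw [List.ofFn_succ, List.prod_cons, ih (fun j => F j.succ) i fun j => hcomm j.succ]
        _ = F i.succ * (F 0 * (List.ofFn fun j => F (i.succAbove j).succ).prod) :=
            (hcomm 0).symm.left_comm _
        _ = F i.succ * (List.ofFn fun j => F (i.succ.succAbove j)).prod := by
            simp [List.ofFn_succ]

theorem sum_pow_eq_sum_prod_ofFn [Semiring R] {ι : Type*} [Fintype ι] (g : ι → R) (r : ℕ) :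
    (∑ a, g a) ^ r = ∑ f : Fin r → ι, (List.ofFn fun i => g (f i)).prod := by
  induction r with
  | zero => simp
  | succ r ih =>
    rw [pow_succ', ih, Finset.sum_mul_sum, ← Fintype.sum_prod_type']
    refine Fintype.sum_equiv (Fin.consEquiv fun _ => ι) _ _ fun f => ?_
    simp [Fin.consEquiv, List.ofFn_succ]

theorem norm_prod_ofFn_le [NormedRing R] [NormOneClass R] {r : ℕ} {F : Fin r → R}
    {w : Fin r → ℝ} (hF : ∀ i, ‖F i‖ ≤ w i) : ‖(List.ofFn F).prod‖ ≤ ∏ i, w i :=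
  calc ‖(List.ofFn F).prod‖ ≤ ((List.ofFn F).map norm).prod := List.norm_prod_le _
    _ = ∏ i, ‖F i‖ := by rw [List.map_ofFn, List.prod_ofFn]; rfl
    _ ≤ ∏ i, w i := Finset.prod_le_prod (fun _ _ => norm_nonneg _) fun i _ => hF i

end OrderedProducts

section Expectation

open Matrix

variable {ι 𝕜 : Type*} [Fintype ι] [DecidableEq ι] [RCLike 𝕜]

theorem norm_apply_le_l2_opNorm (X : Matrix ι ι 𝕜) (i j : ι) : ‖X i j‖ ≤ ‖X‖ :=
  calc ‖X i j‖ = ‖WithLp.toLp 2 (X *ᵥ EuclideanSpace.single j (1 : 𝕜)) i‖ := by simp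
    _ ≤ ‖WithLp.toLp 2 (X *ᵥ EuclideanSpace.single j (1 : 𝕜))‖ := PiLp.norm_apply_le _ i
    _ ≤ ‖X‖ * ‖EuclideanSpace.single j (1 : 𝕜)‖ := l2_opNorm_mulVec X _
    _ = ‖X‖ := by rw [PiLp.norm_single, norm_one, mul_one]

theorem trace_conj_diagonal_mul (U X : Matrix ι ι 𝕜) (c : ι → 𝕜) :
    (U * diagonal c * star U * X).trace = ∑ i, c i * (star U * X * U) i i := by
  rw [mul_assoc, mul_assoc, trace_mul_comm, mul_assoc, trace]
  simp [diagonal_mul]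

theorem norm_trace_mul_le {P : Matrix ι ι 𝕜} (hP : P.PosSemidef) (X : Matrix ι ι 𝕜) :
    ‖(P * X).trace‖ ≤ RCLike.re P.trace * ‖X‖ := by
  let U := hP.isHermitian.eigenvectorUnitary
  let p := hP.isHermitian.eigenvalues
  have hspec : P = (U : Matrix ι ι 𝕜) * diagonal (RCLike.ofReal ∘ p) * star (U : Matrix ι ι 𝕜) :=
    hP.isHermitian.spectral_theorem.trans (Unitary.conjStarAlgAut_apply _ _)
  have htrace : (P * X).trace = ∑ i, (p i : 𝕜) * (star (U : Matrix ι ι 𝕜) * X * U) i i := by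
    conv_lhs => rw [hspec]
    exact trace_conj_diagonal_mul _ _ _
  calc ‖(P * X).trace‖ = ‖∑ i, (p i : 𝕜) * (star (U : Matrix ι ι 𝕜) * X * U) i i‖ := by
        rw [htrace]
    _ ≤ ∑ i, p i * ‖X‖ := norm_sum_le_of_le _ fun i _ => by
        rw [norm_mul, RCLike.norm_ofReal, abs_of_nonneg (hP.eigenvalues_nonneg i)]
        refine mul_le_mul_of_nonneg_left ?_ (hP.eigenvalues_nonneg i)
        refine (norm_apply_le_l2_opNorm _ i i).trans_eq ?_
        rw [CStarRing.norm_mul_coe_unitary, ← Unitary.coe_star, CStarRing.norm_coe_unitary_mul]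
    _ = RCLike.re P.trace * ‖X‖ := by
        rw [hP.isHermitian.trace_eq_sum_eigenvalues, ← RCLike.ofReal_sum, RCLike.ofReal_re,
          Finset.sum_mul]

variable {V : Type*} [Fintype V] [DecidableEq V] {q : ℕ} {ω X Y : Op V q}

theorem expect_add (ω X Y : Op V q) : expect ω (X + Y) = expect ω X + expect ω Y := by
  rw [expect, mul_add, trace_add, expect, expect]

theorem expect_sub (ω X Y : Op V q) : expect ω (X - Y) = expect ω X - expect ω Y := by
  rw [expect, mul_sub, trace_sub, expect, expect]

theorem expect_smul (ω : Op V q) (c : ℂ) (X : Op V q) : expect ω (c • X) = c * expect ω X := by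
  rw [expect, mul_smul_comm, trace_smul, smul_eq_mul, expect]

theorem expect_sum (ω : Op V q) {ι : Type*} (s : Finset ι) (X : ι → Op V q) :
    expect ω (∑ i ∈ s, X i) = ∑ i ∈ s, expect ω (X i) := by
  simp only [expect, Finset.mul_sum, trace_sum]

theorem IsState.expect_one (hω : IsState ω) : expect ω 1 = 1 := by
  rw [expect, mul_one, hω.2]

theorem IsState.nontrivial (hω : IsState ω) : Nontrivial (Op V q) :=
  nontrivial_of_ne ω 0 fun h => by simpa [h] using hω.2

theorem IsState.norm_expect_le (hω : IsState ω) (X : Op V q) : ‖expect ω X‖ ≤ ‖X‖ := by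
  simpa [expect, hω.2] using norm_trace_mul_le hω.1 X

theorem IsState.expect_conjTranspose (hω : IsState ω) (X : Op V q) :
    expect ω Xᴴ = star (expect ω X) := by
  rw [expect, expect, ← trace_conjTranspose, conjTranspose_mul, hω.1.isHermitian.eq,
    trace_mul_comm]

theorem IsState.ofReal_re_expect (hω : IsState ω) (hX : X.IsHermitian) :
    ((expect ω X).re : ℂ) = expect ω X :=
  Complex.conj_eq_iff_re.1 (by rw [← Complex.star_def, ← hω.expect_conjTranspose, hX.eq])

theorem IsState.expect_mul_add_conjTranspose (hω : IsState ω) (hX : X.IsHermitian)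
    (hXY : Commute X Yᴴ) : expect ω (X * (Y + Yᴴ)) = 2 * (expect ω (X * Y)).re := by
  have hadj : X * Yᴴ = (X * Y)ᴴ := by rw [conjTranspose_mul, hX.eq, hXY.eq]
  rw [mul_add, expect_add, hadj, hω.expect_conjTranspose, Complex.star_def, Complex.add_conj,
    Complex.ofReal_mul, Complex.ofReal_ofNat]

theorem IsState.covariance_eq_zero_of_actsOn_empty_left (hω : IsState ω) (hX : ActsOn ∅ X)
    (Y : Op V q) : expect ω (X * Y) - expect ω X * expect ω Y = 0 := by
  obtain ⟨c, rfl⟩ := hX.exists_eq_smul_one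
  rw [smul_mul_assoc, one_mul, expect_smul, expect_smul, hω.expect_one, mul_one, sub_self]

theorem IsState.covariance_eq_zero_of_actsOn_empty_right (hω : IsState ω) (X : Op V q)
    (hY : ActsOn ∅ Y) : expect ω (X * Y) - expect ω X * expect ω Y = 0 := by
  obtain ⟨c, rfl⟩ := hY.exists_eq_smul_one
  rw [mul_smul_comm, mul_one, expect_smul, expect_smul, hω.expect_one, mul_one, mul_comm, sub_self]

end Expectation

section Measurement

open Matrix Finset

theorem sum_mul_exp_le_of_egfSum_le {ι : Type*} [Fintype ι] {p μ : ι → ℝ} {t B : ℝ}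
    (hB : ∀ R, egfSum (fun r => ∑ i, p i * μ i ^ r) R t ≤ B) :
    ∑ i, p i * Real.exp (t * μ i) ≤ B := by
  have hsum (R : ℕ) : egfSum (fun r => ∑ i, p i * μ i ^ r) R t =
      ∑ i, p i * ∑ r ∈ range R, (t * μ i) ^ r / r.factorial := by
    simp only [egfSum, mul_sum, sum_mul, sum_div]
    rw [sum_comm]
    refine sum_congr rfl fun i _ => sum_congr rfl fun r _ => ?_
    rw [mul_pow]
    ring
  have hexp (u : ℝ) : Filter.Tendsto (fun R => ∑ r ∈ range R, u ^ r / r.factorial) Filter.atTop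
      (nhds (Real.exp u)) := by
    rw [Real.exp_eq_exp_ℝ]
    exact (NormedSpace.expSeries_div_hasSum_exp u).tendsto_sum_nat
  exact le_of_tendsto' (tendsto_finsetSum _ fun i _ => (hexp (t * μ i)).const_mul (p i))
    fun R => (hsum R).symm.trans_le (hB R)

theorem sum_ite_le_exp_mul_sum {ι : Type*} [Fintype ι] {p μ : ι → ℝ} {t : ℝ}
    (hp : ∀ i, 0 ≤ p i) (ht : 0 ≤ t) (b : ℝ) :
    (∑ i, p i * if b ≤ μ i then 1 else 0) ≤
      Real.exp (-(t * b)) * ∑ i, p i * Real.exp (t * μ i) := by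
  rw [mul_sum]
  refine sum_le_sum fun i _ => ?_
  rw [mul_left_comm, ← Real.exp_add]
  refine mul_le_mul_of_nonneg_left ?_ (hp i)
  split_ifs with hi
  · exact Real.one_le_exp (by linarith [mul_le_mul_of_nonneg_left hi ht])
  · positivity

variable {V : Type*} [Fintype V] [DecidableEq V] {q : ℕ} {ω H : Op V q}

/-- The probability that a measurement of `H` in the state `ω` finds the `i`-th vector of the
chosen eigenbasis of `H`. -/
def bornWeight (ω : Op V q) (hH : H.IsHermitian) (i : V → Fin q) : ℝ :=
  ((star (hH.eigenvectorUnitary : Op V q) * ω * hH.eigenvectorUnitary) i i).re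

theorem IsState.bornWeight_nonneg (hω : IsState ω) (hH : H.IsHermitian) (i : V → Fin q) :
    0 ≤ bornWeight ω hH i :=
  (Complex.le_def.1 (hω.1.conjTranspose_mul_mul_same _).diag_nonneg).1

theorem re_expect_cfc (ω : Op V q) (hH : H.IsHermitian) (f : ℝ → ℝ) :
    (expect ω (cfc f H)).re = ∑ i, bornWeight ω hH i * f (hH.eigenvalues i) := by
  rw [hH.cfc_eq, Matrix.IsHermitian.cfc, Unitary.conjStarAlgAut_apply, expect, trace_mul_comm,
    trace_conj_diagonal_mul, Complex.re_sum]
  exact sum_congr rfl fun i _ => (Complex.re_ofReal_mul _ _).trans (mul_comm _ _)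

theorem probGE_eq_sum_bornWeight (ω : Op V q) (hH : H.IsHermitian) (c : ℝ) :
    probGE ω hH c = ∑ i, bornWeight ω hH i * if c ≤ hH.eigenvalues i then 1 else 0 := by
  rw [← re_expect_cfc ω hH fun l => if c ≤ l then 1 else 0, hH.cfc_eq, Matrix.IsHermitian.cfc,
    Unitary.conjStarAlgAut_apply, probGE, spectralProj]
  congr! with i
  simp [apply_ite]

theorem re_expect_sub_smul_one_pow (ω : Op V q) (hH : H.IsHermitian) (m : ℝ) (r : ℕ) :
    (expect ω ((H - (m : ℂ) • 1) ^ r)).re =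
      ∑ i, bornWeight ω hH i * (hH.eigenvalues i - m) ^ r := by
  have hH' : IsSelfAdjoint H := hH
  rw [← re_expect_cfc ω hH fun l => (l - m) ^ r, cfc_pow _ _ H, cfc_sub _ _ H, cfc_id' ℝ H,
    cfc_const m H, Algebra.algebraMap_eq_smul_one, Complex.coe_smul]

theorem IsState.probGE_le_of_egfSum_le (hω : IsState ω) (hH : H.IsHermitian) (m b : ℝ)
    {t B : ℝ} (ht : 0 ≤ t)
    (hB : ∀ R, egfSum (fun r => (expect ω ((H - (m : ℂ) • 1) ^ r)).re) R t ≤ B) :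
    probGE ω hH (m + b) ≤ Real.exp (-(t * b)) * B := by
  simp only [re_expect_sub_smul_one_pow ω hH] at hB
  simp only [probGE_eq_sum_bornWeight, ← le_sub_iff_add_le']
  exact (sum_ite_le_exp_mul_sum (hω.bornWeight_nonneg hH) ht b).trans
    (mul_le_mul_of_nonneg_left (sum_mul_exp_le_of_egfSum_le hB) (Real.exp_pos _).le)

end Measurement

section CorrelationDecay

open Matrix

variable {V : Type*} [MetricSpace V] {l : ℝ} {Λ₁ Λ₂ : Finset V}

theorem le_regionDist (h₁ : Λ₁.Nonempty) (h₂ : Λ₂.Nonempty)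
    (hdist : ∀ x ∈ Λ₁, ∀ y ∈ Λ₂, l ≤ dist x y) : l ≤ regionDist Λ₁ Λ₂ := by
  obtain ⟨x, hx⟩ := h₁
  obtain ⟨y, hy⟩ := h₂
  refine le_csInf ⟨_, x, hx, y, hy, rfl⟩ ?_
  rintro _ ⟨x', hx', y', hy', rfl⟩
  exact hdist x' hx' y' hy'

theorem disjoint_of_forall_lt_dist (hl : 0 ≤ l) (hdist : ∀ x ∈ Λ₁, ∀ y ∈ Λ₂, l < dist x y) :
    Disjoint Λ₁ Λ₂ :=
  Finset.disjoint_left.2 fun x hx₁ hx₂ =>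
    absurd (hl.trans_lt (hdist x hx₁ x hx₂)) (by simp)

variable [Fintype V] [DecidableEq V] {q : ℕ} {ω X Y : Op V q} {ξ C ε : ℝ}

/-- Observables on regions more than `l` apart have a covariance of at most `ε` times the product
of their norms. -/
def CorrelationsBounded (ω : Op V q) (l ε : ℝ) : Prop :=
  ∀ Λ₁ Λ₂ : Finset V, (∀ x ∈ Λ₁, ∀ y ∈ Λ₂, l < dist x y) → ∀ h₁ h₂ : Op V q,
    h₁.IsHermitian → ActsOn Λ₁ h₁ → h₂.IsHermitian → ActsOn Λ₂ h₂ →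
      ‖expect ω (h₁ * h₂) - expect ω h₁ * expect ω h₂‖ ≤ ε * ‖h₁‖ * ‖h₂‖

theorem HasCorrelationLength.correlationsBounded (hcorr : HasCorrelationLength ω ξ C)
    (hω : IsState ω) (hξ : 0 < ξ) (hC : 0 ≤ C) (hl : 0 ≤ l) :
    CorrelationsBounded ω l (C * Real.exp (-(l / ξ))) := by
  intro Λ₁ Λ₂ hdist h₁ h₂ hh₁ hΛ₁ hh₂ hΛ₂
  rcases Λ₁.eq_empty_or_nonempty with rfl | hne₁
  · rw [hω.covariance_eq_zero_of_actsOn_empty_left hΛ₁, norm_zero]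
    positivity
  rcases Λ₂.eq_empty_or_nonempty with rfl | hne₂
  · rw [hω.covariance_eq_zero_of_actsOn_empty_right h₁ hΛ₂, norm_zero]
    positivity
  have hlDist : l ≤ regionDist Λ₁ Λ₂ :=
    le_regionDist hne₁ hne₂ fun x hx y hy => (hdist x hx y hy).le
  calc ‖expect ω (h₁ * h₂) - expect ω h₁ * expect ω h₂‖
      ≤ C * ‖h₁‖ * ‖h₂‖ * Real.exp (-(regionDist Λ₁ Λ₂ / ξ)) :=
        hcorr Λ₁ Λ₂ hne₁ hne₂ (disjoint_of_forall_lt_dist hl hdist) h₁ h₂ hh₁ hΛ₁ hh₂ hΛ₂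
    _ ≤ C * ‖h₁‖ * ‖h₂‖ * Real.exp (-(l / ξ)) := by gcongr
    _ = C * Real.exp (-(l / ξ)) * ‖h₁‖ * ‖h₂‖ := by ring

theorem CorrelationsBounded.re_expect_mul_le (hcorr : CorrelationsBounded ω l ε)
    (hω : IsState ω) (hl : 0 ≤ l) (hε : 0 ≤ ε) (hdist : ∀ x ∈ Λ₁, ∀ y ∈ Λ₂, l < dist x y)
    (hX : X.IsHermitian) (hXΛ : ActsOn Λ₁ X) (hX₀ : expect ω X = 0) (hYΛ : ActsOn Λ₂ Y) :
    (expect ω (X * Y)).re ≤ ε * (‖X‖ * ‖Y‖) := by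
  have hadj : ActsOn Λ₂ Yᴴ := mem_localAlgebra.1 (star_mem (mem_localAlgebra.2 hYΛ))
  have hsum : ActsOn Λ₂ (Y + Yᴴ) :=
    mem_localAlgebra.1 (add_mem (mem_localAlgebra.2 hYΛ) (mem_localAlgebra.2 hadj))
  have hcov := hcorr Λ₁ Λ₂ hdist X (Y + Yᴴ) hX hXΛ (isHermitian_add_transpose_self Y) hsum
  have hcomm : Commute X Yᴴ := hXΛ.commute (disjoint_of_forall_lt_dist hl hdist) hadj
  rw [hX₀, zero_mul, sub_zero, hω.expect_mul_add_conjTranspose hX hcomm, norm_mul,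
    Complex.norm_ofNat, Complex.norm_real] at hcov
  have hnorm : ‖Y + Yᴴ‖ ≤ 2 * ‖Y‖ := by
    rw [two_mul]
    exact norm_add_le_of_le le_rfl (l2_opNorm_conjTranspose Y).le
  have hbound : ε * ‖X‖ * ‖Y + Yᴴ‖ ≤ ε * ‖X‖ * (2 * ‖Y‖) := by gcongr
  linarith [Real.le_norm_self (expect ω (X * Y)).re]

end CorrelationDecay

section Proximity

open Finset

variable {V ι : Type*} {supp : ι → Finset V} {w : ι → ℝ} {k : ℕ} {l L M : ℝ}

theorem sum_mul_card_supp_le [Fintype V] [Fintype ι] [DecidableEq V]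
    (hL : ∀ x, ∑ a with x ∈ supp a, w a ≤ L) :
    ∑ a, w a * #(supp a) ≤ Fintype.card V * L :=
  calc ∑ a, w a * #(supp a) = ∑ a, ∑ _x ∈ supp a, w a := by
        simp only [sum_const, nsmul_eq_mul, mul_comm]
    _ = ∑ x, ∑ a with x ∈ supp a, w a := sum_comm' (by simp)
    _ ≤ Fintype.card V * L := by
        rw [← Finset.card_univ, ← nsmul_eq_mul]
        exact sum_le_card_nsmul _ _ _ fun x _ => hL x

variable [MetricSpace V]

/-- The regions with labels `a` and `b` come within distance `l` of each other. -/
def Near (supp : ι → Finset V) (l : ℝ) (a b : ι) : Prop :=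
  ∃ x ∈ supp a, ∃ y ∈ supp b, dist x y ≤ l

theorem near_symm (supp : ι → Finset V) (l : ℝ) : Std.Symm (Near supp l) where
  symm := fun _ _ ⟨x, hx, y, hy, hxy⟩ => ⟨y, hy, x, hx, dist_comm x y ▸ hxy⟩

variable [Fintype ι] [DecidableEq V]

open Classical in
theorem sum_near_le [Finite V] (hw : ∀ a, 0 ≤ w a) (hM : ∀ x : V, (Metric.closedBall x l).ncard ≤ M)
    (hL₀ : 0 ≤ L) (hL : ∀ x, ∑ a with x ∈ supp a, w a ≤ L) (a : ι) :
    ∑ b with Near supp l a b, w b ≤ #(supp a) * (M * L) := by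
  cases nonempty_fintype V
  let nbhd : Finset V := (supp a).biUnion fun x => (Metric.closedBall x l).toFinset
  have hcover (b : ι) : Near supp l a b → ∃ y ∈ nbhd, y ∈ supp b := by
    rintro ⟨x, hx, y, hy, hxy⟩
    refine ⟨y, mem_biUnion.2 ⟨x, hx, ?_⟩, hy⟩
    rwa [Set.mem_toFinset, Metric.mem_closedBall']
  have hcard : (#nbhd : ℝ) ≤ #(supp a) * M :=
    calc (#nbhd : ℝ) ≤ ∑ x ∈ supp a, (#(Metric.closedBall x l).toFinset : ℝ) :=
          mod_cast card_biUnion_le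
      _ ≤ #(supp a) * M := by
          rw [← nsmul_eq_mul]
          exact sum_le_card_nsmul _ _ _ fun x _ =>
            (congrArg _ (Set.ncard_eq_toFinset_card' _)).ge.trans (hM x)
  calc ∑ b with Near supp l a b, w b ≤ ∑ y ∈ nbhd, ∑ b with y ∈ supp b, w b :=
        sum_filter_le_sum_sum_filter hw hcover
    _ ≤ #nbhd * L := by
        rw [← nsmul_eq_mul]
        exact sum_le_card_nsmul _ _ _ fun y _ => hL y
    _ ≤ #(supp a) * (M * L) := by
        rw [← mul_assoc]
        exact mul_le_mul_of_nonneg_right hcard hL₀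

theorem starWeight_near_le [Fintype V] (hw : ∀ a, 0 ≤ w a) (hk : 0 < k)
    (hcard : ∀ a, #(supp a) ≤ k) (hM₀ : 0 ≤ M) (hM : ∀ x : V, (Metric.closedBall x l).ncard ≤ M)
    (hL₀ : 0 ≤ L) (hL : ∀ x, ∑ a with x ∈ supp a, w a ≤ L) {m : ℕ} (hm : m ≠ 0) :
    starWeight (Near supp l) w m ≤ Fintype.card V * L / k * (k * M * L) ^ m := by
  classical
  obtain ⟨m, rfl⟩ := Nat.exists_eq_succ_of_ne_zero hm
  have hpow (a : ι) : (#(supp a) : ℝ) ^ (m + 1) ≤ #(supp a) * k ^ m := by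
    rw [pow_succ']
    have := hcard a
    gcongr
  calc starWeight (Near supp l) w (m + 1)
      ≤ ∑ a, w a * (#(supp a) * (M * L)) ^ (m + 1) := by
        refine sum_le_sum fun a _ => mul_le_mul_of_nonneg_left ?_ (hw a)
        exact pow_le_pow_left₀ (sum_nonneg fun b _ => hw b) (sum_near_le hw hM hL₀ hL a) _
    _ ≤ ∑ a, w a * (#(supp a) * k ^ m * (M * L) ^ (m + 1)) := by
        refine sum_le_sum fun a _ => mul_le_mul_of_nonneg_left ?_ (hw a)
        rw [mul_pow]
        exact mul_le_mul_of_nonneg_right (hpow a) (by positivity)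
    _ = (∑ a, w a * #(supp a)) * (k ^ m * (M * L) ^ (m + 1)) := by
        simp only [sum_mul, mul_assoc]
    _ ≤ Fintype.card V * L * (k ^ m * (M * L) ^ (m + 1)) :=
        mul_le_mul_of_nonneg_right (sum_mul_card_supp_le hL) (by positivity)
    _ = Fintype.card V * L / k * (k * M * L) ^ (m + 1) := by
        field_simp
        ring

end Proximity

section Moments

open Finset

variable {V ι : Type*} [Fintype V] [DecidableEq V] {q : ℕ} {ω : Op V q}
  {supp : ι → Finset V} {g : ι → Op V q} {w : ι → ℝ} {l ε : ℝ}

/-- The observables `g a`, acting on the nonempty regions `supp a`, have expectation zero in the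
state `ω` and norms at most `w a`. -/
structure IsCenteredFamily (ω : Op V q) (supp : ι → Finset V) (g : ι → Op V q) (w : ι → ℝ) :
    Prop where
  nonempty (a : ι) : (supp a).Nonempty
  isHermitian (a : ι) : (g a).IsHermitian
  actsOn (a : ι) : ActsOn (supp a) (g a)
  expect_eq_zero (a : ι) : expect ω (g a) = 0
  norm_le (a : ι) : ‖g a‖ ≤ w a

theorem IsCenteredFamily.weight_nonneg (hg : IsCenteredFamily ω supp g w) (a : ι) : 0 ≤ w a :=
  (norm_nonneg _).trans (hg.norm_le a)

theorem IsCenteredFamily.sum_weight_le [Fintype ι]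
    (hg : IsCenteredFamily ω supp g w) {L : ℝ}
    (hL : ∀ x, ∑ a with x ∈ supp a, w a ≤ L) : ∑ a, w a ≤ Fintype.card V * L :=
  (sum_le_sum fun a _ => le_mul_of_one_le_right (hg.weight_nonneg a)
    (mod_cast (hg.nonempty a).card_pos)).trans (sum_mul_card_supp_le hL)

theorem IsCenteredFamily.actsOn_prod_ofFn (hg : IsCenteredFamily ω supp g w) {r : ℕ}
    (f : Fin r → ι) :
    ActsOn (univ.biUnion fun i => supp (f i)) (List.ofFn fun i => g (f i)).prod := by
  refine mem_localAlgebra.1 (list_prod_mem fun X hX => ?_)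
  obtain ⟨i, rfl⟩ := (List.mem_ofFn' _ _).1 hX
  exact mem_localAlgebra.2 ((hg.actsOn _).mono
    (subset_biUnion_of_mem (fun i => supp (f i)) (mem_univ i)))

variable [MetricSpace V]

theorem IsCenteredFamily.re_expect_prod_ofFn_le (hg : IsCenteredFamily ω supp g w)
    (hω : IsState ω) (hl : 0 ≤ l) (hε : 0 ≤ ε) (hcorr : CorrelationsBounded ω l ε) {r : ℕ}
    {f : Fin r → ι} (hf : ¬ NoIsolated (Near supp l) f) :
    (expect ω (List.ofFn fun i => g (f i)).prod).re ≤ ε * ∏ i, w (f i) := by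
  have := hω.nontrivial
  obtain ⟨i, hi⟩ : ∃ i, ∀ j, j ≠ i → ¬ Near supp l (f i) (f j) := by
    simpa only [NoIsolated, not_forall, not_exists, not_and] using hf
  obtain _ | r := r
  · exact i.elim0
  have hfar (j) (hj : j ≠ i) : ∀ x ∈ supp (f i), ∀ y ∈ supp (f j), l < dist x y :=
    fun x hx y hy => not_le.1 fun hxy => hi j hj ⟨x, hx, y, hy, hxy⟩
  have hcomm (j) : Commute (g (f i)) (g (f j)) := by
    rcases eq_or_ne j i with rfl | hj
    · exact Commute.refl _
    · exact (hg.actsOn _).commute (disjoint_of_forall_lt_dist hl (hfar j hj)) (hg.actsOn _)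
  have hfar' : ∀ x ∈ supp (f i), ∀ y ∈ univ.biUnion fun j => supp (f (i.succAbove j)),
      l < dist x y := by
    intro x hx y hy
    obtain ⟨j, -, hy⟩ := mem_biUnion.1 hy
    exact hfar _ (i.succAbove_ne j) x hx y hy
  rw [prod_ofFn_eq_mul_of_commute (fun i => g (f i)) i hcomm, Fin.prod_univ_succAbove _ i]
  refine (hcorr.re_expect_mul_le hω hl hε hfar' (hg.isHermitian _) (hg.actsOn _)
    (hg.expect_eq_zero _) (hg.actsOn_prod_ofFn _)).trans (mul_le_mul_of_nonneg_left ?_ hε)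
  exact mul_le_mul (hg.norm_le _) (norm_prod_ofFn_le fun _ => hg.norm_le _) (norm_nonneg _)
    (hg.weight_nonneg _)

variable [Fintype ι]

theorem IsCenteredFamily.re_expect_sum_pow_le (hg : IsCenteredFamily ω supp g w)
    (hω : IsState ω) (hl : 0 ≤ l) (hε : 0 ≤ ε) (hcorr : CorrelationsBounded ω l ε) (r : ℕ) :
    (expect ω ((∑ a, g a) ^ r)).re ≤
      clusterWeight (Fin r) (Near supp l) w + ε * (∑ a, w a) ^ r := by
  classical
  have := hω.nontrivial
  rw [sum_pow_eq_sum_prod_ofFn, expect_sum, Complex.re_sum, clusterWeight, Fintype.sum_pow,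
    mul_sum, sum_filter, ← sum_add_distrib]
  refine sum_le_sum fun f _ => ?_
  split_ifs with hf
  · have hprod : 0 ≤ ∏ i, w (f i) := prod_nonneg fun i _ => hg.weight_nonneg _
    calc (expect ω (List.ofFn fun i => g (f i)).prod).re
        ≤ ‖(List.ofFn fun i => g (f i)).prod‖ :=
          (Complex.re_le_norm _).trans (hω.norm_expect_le _)
      _ ≤ ∏ i, w (f i) := norm_prod_ofFn_le fun i => hg.norm_le _
      _ ≤ ∏ i, w (f i) + ε * ∏ i, w (f i) := le_add_of_nonneg_right (mul_nonneg hε hprod)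
  · rw [zero_add]
    exact hg.re_expect_prod_ofFn_le hω hl hε hcorr hf

theorem egfSum_pow_le_exp {u t : ℝ} (hu : 0 ≤ u) (ht : 0 ≤ t) (R : ℕ) :
    egfSum (fun r => u ^ r) R t ≤ Real.exp (u * t) := by
  simpa only [egfSum, ← mul_pow] using Real.sum_le_exp_of_nonneg (mul_nonneg hu ht) R

theorem IsCenteredFamily.egfSum_re_expect_sum_pow_le (hg : IsCenteredFamily ω supp g w)
    (hω : IsState ω) (hl : 0 ≤ l) (hε : 0 ≤ ε) (hcorr : CorrelationsBounded ω l ε) {k : ℕ}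
    (hk : 0 < k) (hcard : ∀ a, #(supp a) ≤ k) {M L : ℝ} (hM₀ : 0 < M)
    (hM : ∀ x : V, (Metric.closedBall x l).ncard ≤ M) (hL₀ : 0 < L)
    (hL : ∀ x, ∑ a with x ∈ supp a, w a ≤ L) {t : ℝ} (ht : 0 ≤ t) (R : ℕ) :
    egfSum (fun r => (expect ω ((∑ a, g a) ^ r)).re) R t ≤
      Real.exp (Fintype.card V / (k ^ 2 * M) * starSeries (k * M * L * t)) +
        ε * Real.exp (Fintype.card V * L * t) := by
  have hcluster := egfSum_clusterWeight_le (near_symm supp l) hg.weight_nonneg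
    (W := Fintype.card V * L / k) (K := k * M * L) (by positivity) (by positivity)
    (fun m hm => starWeight_near_le hg.weight_nonneg hk hcard hM₀.le hM hL₀.le hL hm) ht R
  have hratio : Fintype.card V * L / k / (k * M * L) = Fintype.card V / (k ^ 2 * M) := by
    field_simp
  have htotal : egfSum (fun r => (∑ a, w a) ^ r) R t ≤ Real.exp (Fintype.card V * L * t) :=
    (egfSum_pow_le_exp (sum_nonneg fun a _ => hg.weight_nonneg a) ht R).trans
      (Real.exp_le_exp.2 (mul_le_mul_of_nonneg_right (hg.sum_weight_le hL) ht))
  calc egfSum (fun r => (expect ω ((∑ a, g a) ^ r)).re) R t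
      ≤ egfSum (fun r => clusterWeight (Fin r) (Near supp l) w + ε * (∑ a, w a) ^ r) R t :=
        egfSum_mono (hg.re_expect_sum_pow_le hω hl hε hcorr) ht
    _ = egfSum (fun r => clusterWeight (Fin r) (Near supp l) w) R t +
          ε * egfSum (fun r => (∑ a, w a) ^ r) R t := by
        simp only [egfSum, add_mul, add_div, sum_add_distrib, mul_sum, mul_assoc, mul_div_assoc]
    _ ≤ _ := add_le_add (hratio ▸ hcluster) (mul_le_mul_of_nonneg_left htotal hε)

end Moments

section Decompositions

open Finset

variable {V : Type*} [Fintype V] [DecidableEq V] {q k : ℕ} {Λ : Finset V} {ω X H : Op V q}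
  {h : Finset V → Op V q}

/-- The deviation of the observable `X` from its expectation in the state `ω`. -/
def centered (ω X : Op V q) : Op V q :=
  X - expect ω X • 1

theorem IsState.expect_centered (hω : IsState ω) (X : Op V q) : expect ω (centered ω X) = 0 := by
  rw [centered, expect_sub, expect_smul, hω.expect_one, mul_one, sub_self]

theorem IsState.isHermitian_centered (hω : IsState ω) (hX : X.IsHermitian) :
    (centered ω X).IsHermitian := by
  rw [centered, ← hω.ofReal_re_expect hX, Complex.coe_smul]
  exact hX.sub ((IsSelfAdjoint.all (expect ω X).re).smul (IsSelfAdjoint.one _))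

theorem IsState.norm_centered_le (hω : IsState ω) (X : Op V q) : ‖centered ω X‖ ≤ 2 * ‖X‖ := by
  have := hω.nontrivial
  calc ‖centered ω X‖ ≤ ‖X‖ + ‖expect ω X • (1 : Op V q)‖ := norm_sub_le _ _
    _ ≤ ‖X‖ + ‖X‖ := by
        rw [norm_smul, norm_one, mul_one]
        exact add_le_add_right (hω.norm_expect_le X) _
    _ = 2 * ‖X‖ := (two_mul _).symm

theorem ActsOn.centered (hX : ActsOn Λ X) (ω : Op V q) : ActsOn Λ (centered ω X) :=
  mem_localAlgebra.1 (sub_mem (mem_localAlgebra.2 hX) ((localAlgebra q Λ).smul_mem (one_mem _) _))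

theorem IsState.centered_eq_zero_of_actsOn_empty (hω : IsState ω) (hX : ActsOn ∅ X) :
    centered ω X = 0 := by
  obtain ⟨c, rfl⟩ := hX.exists_eq_smul_one
  rw [SpinSystem.centered, expect_smul, hω.expect_one, mul_one, sub_self]

/-- The nonempty regions of at most `k` spins. -/
abbrev Region (V : Type*) (k : ℕ) : Type _ :=
  {Λ : Finset V // Λ.Nonempty ∧ #Λ ≤ k}

theorem IsDecomposition.sum_centered (hdec : IsDecomposition k H h) (hω : IsState ω) :
    ∑ Λ : Region V k, centered ω (h Λ) = centered ω H := by
  calc ∑ Λ : Region V k, centered ω (h Λ)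
      = ∑ Λ with Λ.Nonempty ∧ #Λ ≤ k, centered ω (h Λ) :=
        (sum_subtype _ (by simp) fun Λ => centered ω (h Λ)).symm
    _ = ∑ Λ with #Λ ≤ k, centered ω (h Λ) := by
        refine sum_subset (monotone_filter_right _ fun _ _ hΛ => hΛ.2) fun Λ hΛ hΛ' => ?_
        simp only [mem_filter_univ, not_and'] at hΛ hΛ'
        obtain rfl := not_nonempty_iff_eq_empty.1 (hΛ' hΛ)
        exact hω.centered_eq_zero_of_actsOn_empty (hdec.actsOn ∅)
    _ = centered ω H := by
        simp only [centered, sum_sub_distrib, ← sum_smul, ← expect_sum, ← hdec.sum_eq]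

theorem IsDecomposition.isCenteredFamily (hdec : IsDecomposition k H h) (hω : IsState ω) :
    IsCenteredFamily ω (fun Λ : Region V k => Λ.1) (fun Λ => centered ω (h Λ))
      fun Λ => 2 * ‖h Λ‖ where
  nonempty Λ := Λ.2.1
  isHermitian Λ := hω.isHermitian_centered (hdec.isHermitian Λ)
  actsOn Λ := (hdec.actsOn Λ).centered ω
  expect_eq_zero Λ := hω.expect_centered (h Λ)
  norm_le Λ := hω.norm_centered_le (h Λ)

theorem sum_region_le_dependence (h : Finset V → Op V q) (x : V) :
    ∑ Λ : Region V k with x ∈ Λ.1, 2 * ‖h Λ‖ ≤ dependence k h := by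
  calc ∑ Λ : Region V k with x ∈ Λ.1, 2 * ‖h Λ‖
      = 2 * ∑ Λ with x ∈ Λ ∧ #Λ ≤ k, ‖h Λ‖ := by
        rw [mul_sum, sum_filter, ← sum_subtype {Λ : Finset V | Λ.Nonempty ∧ #Λ ≤ k} (by simp)
          fun Λ => if x ∈ Λ then 2 * ‖h Λ‖ else 0, ← sum_filter, filter_filter]
        refine sum_congr (filter_congr fun Λ _ => ?_) fun _ _ => rfl
        exact ⟨fun hΛ => ⟨hΛ.2, hΛ.1.2⟩, fun hΛ => ⟨⟨⟨x, hΛ.1⟩, hΛ.2⟩, hΛ.1⟩⟩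
    _ ≤ dependence k h :=
        mul_le_mul_of_nonneg_left (le_ciSup (f := fun x => ∑ Λ with x ∈ Λ ∧ #Λ ≤ k, ‖h Λ‖)
          (Set.finite_range _).bddAbove x) zero_le_two

theorem dependence_eq_zero [IsEmpty (Region V k)] (h : Finset V → Op V q) :
    dependence k h = 0 := by
  have hsum (x : V) : ∑ Λ with x ∈ Λ ∧ #Λ ≤ k, ‖h Λ‖ = 0 :=
    sum_eq_zero fun Λ hΛ => by
      obtain ⟨hx, hcard⟩ := mem_filter_univ _ |>.1 hΛ
      exact isEmptyElim (⟨Λ, ⟨x, hx⟩, hcard⟩ : Region V k)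
  simp only [dependence, hsum, Real.iSup_const_zero, mul_zero]

theorem nonempty_region_of_localNorm_pos (hloc : 0 < localNorm k H) : Nonempty (Region V k) := by
  by_contra hempty
  rw [not_nonempty_iff] at hempty
  refine hloc.not_ge (Real.sInf_nonpos ?_)
  rintro _ ⟨h, -, rfl⟩
  exact (dependence_eq_zero h).le

theorem exists_isDecomposition_dependence_lt (hloc : 0 < localNorm k H) {L : ℝ}
    (hL : localNorm k H < L) : ∃ h, IsDecomposition k H h ∧ dependence k h < L := by
  have hne :
      {b | ∃ h : Finset V → Op V q, IsDecomposition k H h ∧ b = dependence k h}.Nonempty := by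
    refine Set.nonempty_iff_ne_empty.2 fun hempty => hloc.ne' ?_
    rw [localNorm, hempty, Real.sInf_empty]
  obtain ⟨_, ⟨h, hdec, rfl⟩, hlt⟩ := exists_lt_of_csInf_lt hne hL
  exact ⟨h, hdec, hlt⟩

end Decompositions

section BallGrowth

variable {V : Type*} [MetricSpace V] {A d r₀ : ℝ}

theorem BallGrowth.one_le_mul_rpow [Finite V] [Nonempty V] (hball : BallGrowth V A d r₀) {r : ℝ}
    (hr₀ : r₀ ≤ r) (hr : 0 ≤ r) : 1 ≤ A * r ^ d := by
  obtain ⟨v⟩ := ‹Nonempty V›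
  have hpos : 0 < (Metric.closedBall v r).ncard :=
    (Set.ncard_pos (Set.toFinite _)).2 ⟨v, Metric.mem_closedBall_self hr⟩
  exact (Nat.one_le_cast.2 hpos).trans (hball v r hr₀)

theorem BallGrowth.constant_pos [Finite V] [Nonempty V] (hball : BallGrowth V A d r₀) :
    0 < A := by
  have hle : 1 ≤ A * max r₀ 1 ^ d :=
    hball.one_le_mul_rpow (le_max_left r₀ 1) (zero_le_one.trans (le_max_right r₀ 1))
  exact pos_of_mul_pos_left (zero_lt_one.trans_le hle) (by positivity)

theorem BallGrowth.exponent_nonneg [Finite V] [Nonempty V] (hball : BallGrowth V A d r₀) :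
    0 ≤ d := by
  by_contra! hd
  have hlim : Filter.Tendsto (fun r : ℝ => A * r ^ d) Filter.atTop (nhds (A * 0)) := by
    simpa only [neg_neg] using (tendsto_rpow_neg_atTop (neg_pos.2 hd)).const_mul A
  have hle : 1 ≤ A * 0 := ge_of_tendsto hlim <| by
    filter_upwards [Filter.eventually_ge_atTop r₀, Filter.eventually_ge_atTop 0] with r hr₀ hr
    exact hball.one_le_mul_rpow hr₀ hr
  linarith

end BallGrowth

section Concentration

variable {V : Type*} [Fintype V] [DecidableEq V] [MetricSpace V] {q k : ℕ} {ω H : Op V q}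
  {l ε M : ℝ}

theorem IsDecomposition.probGE_le {h : Finset V → Op V q} (hdec : IsDecomposition k H h)
    (hω : IsState ω) (hl : 0 ≤ l) (hε : 0 ≤ ε) (hcorr : CorrelationsBounded ω l ε) (hk : 0 < k)
    (hH : H.IsHermitian) (hM₀ : 0 < M) (hM : ∀ x : V, (Metric.closedBall x l).ncard ≤ M)
    {L : ℝ} (hL₀ : 0 < L) (hL : dependence k h ≤ L) {t : ℝ} (ht : 0 ≤ t) (b : ℝ) :
    probGE ω hH ((expect ω H).re + b) ≤ Real.exp (-(t * b)) *
      (Real.exp (Fintype.card V / (k ^ 2 * M) * starSeries (k * M * L * t)) +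
        ε * Real.exp (Fintype.card V * L * t)) := by
  refine hω.probGE_le_of_egfSum_le hH _ b ht fun R => ?_
  rw [hω.ofReal_re_expect hH, ← centered, ← hdec.sum_centered hω]
  exact (hdec.isCenteredFamily hω).egfSum_re_expect_sum_pow_le hω hl hε hcorr hk (fun Λ => Λ.2.2)
    hM₀ hM hL₀ (fun x => (sum_region_le_dependence h x).trans hL) ht R

theorem IsState.probGE_le_of_localNorm (hω : IsState ω) (hl : 0 ≤ l) (hε : 0 ≤ ε)
    (hcorr : CorrelationsBounded ω l ε) (hk : 0 < k) (hH : H.IsHermitian)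
    (hloc : 0 < localNorm k H) (hM₀ : 0 < M) (hM : ∀ x : V, (Metric.closedBall x l).ncard ≤ M)
    {t : ℝ} (ht : 0 ≤ t) (b : ℝ) :
    probGE ω hH ((expect ω H).re + b) ≤ Real.exp (-(t * b)) *
      (Real.exp (Fintype.card V / (k ^ 2 * M) * starSeries (k * M * localNorm k H * t)) +
        ε * Real.exp (Fintype.card V * localNorm k H * t)) := by
  have hcont : Continuous fun L : ℝ => Real.exp (-(t * b)) *
      (Real.exp (Fintype.card V / (k ^ 2 * M) * starSeries (k * M * L * t)) +
        ε * Real.exp (Fintype.card V * L * t)) := by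
    unfold starSeries
    fun_prop
  refine ge_of_tendsto (hcont.continuousWithinAt (s := Set.Ioi (localNorm k H))) ?_
  filter_upwards [self_mem_nhdsWithin] with L hL
  obtain ⟨h, hdec, hlt⟩ := exists_isDecomposition_dependence_lt hloc hL
  exact hdec.probGE_le hω hl hε hcorr hk hH hM₀ hM (hloc.trans hL) hlt.le ht b

variable {ξ C a x s A d r₀ : ℝ}

theorem IsState.probGE_le_of_tilt (hω : IsState ω) (hl : 0 ≤ l) (hε : 0 ≤ ε)
    (hcorr : CorrelationsBounded ω l ε) (hk : 0 < k) (hH : H.IsHermitian)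
    (hloc : 0 < localNorm k H) (hM₁ : 1 ≤ M) (hM : ∀ v : V, (Metric.closedBall v l).ncard ≤ M)
    (ha : 0 ≤ a) (hx : x = a * k / localNorm k H) (hs : 0 ≤ s) :
    probGE ω hH ((expect ω H).re + Fintype.card V * a) ≤
      Real.exp (-(Fintype.card V * ((s * x - starSeries s) / (k ^ 2 * M ^ 2)))) +
        ε * Real.exp (Fintype.card V * (s / (k * M ^ 2))) := by
  have hM₀ : 0 < M := zero_lt_one.trans_le hM₁
  let t := s / (k * M ^ 2 * localNorm k H)
  have ht : 0 ≤ t := by positivity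
  have htilt : t * (Fintype.card V * a) = Fintype.card V * (s * x / (k ^ 2 * M ^ 2)) := by
    simp only [t, hx]
    field_simp
  have hstar_arg : k * M * localNorm k H * t = M⁻¹ * s := by
    simp only [t]
    field_simp
  have hfar_arg : Fintype.card V * localNorm k H * t = Fintype.card V * (s / (k * M ^ 2)) := by
    simp only [t]
    field_simp
  have hstar : Fintype.card V / (k ^ 2 * M) * starSeries (M⁻¹ * s) ≤
      Fintype.card V * (starSeries s / (k ^ 2 * M ^ 2)) :=
    calc Fintype.card V / (k ^ 2 * M) * starSeries (M⁻¹ * s)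
        ≤ Fintype.card V / (k ^ 2 * M) * (M⁻¹ * starSeries s) := by
          gcongr
          exact starSeries_mul_le hs (by positivity) (inv_le_one_of_one_le₀ hM₁)
      _ = Fintype.card V * (starSeries s / (k ^ 2 * M ^ 2)) := by field_simp
  have hbound := hω.probGE_le_of_localNorm hl hε hcorr hk hH hloc hM₀ hM ht (Fintype.card V * a)
  rw [hstar_arg, hfar_arg, mul_add, ← Real.exp_add] at hbound
  refine hbound.trans (add_le_add (Real.exp_le_exp.2 ?_) ?_)
  · rw [htilt, sub_div, mul_sub]
    linarith
  · exact mul_le_of_le_one_left (by positivity)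
      (Real.exp_le_one_iff.2 (neg_nonpos.2 (by positivity)))

theorem rateF_pos (hx : 0 < x) : 0 < rateF x := by
  have hlog : 0 < Real.log (1 + x) := Real.log_pos (by linarith)
  calc 0 < Real.log (1 + x) ^ 2 / 2 := by positivity
    _ = rateAux x (Real.log (1 + x)) := by
        rw [rateAux, Real.exp_log (by linarith)]
        ring
    _ ≤ rateAux x (sStar x) := (isMaxOn_sStar hx).2 hlog
    _ = rateF x := (rateF_eq hx).symm

theorem rateF_eq_sub_starSeries (hx : 0 < x) :
    rateF x = sStar x * x - starSeries (sStar x) := by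
  rw [rateF_eq hx, rateAux, starSeries]
  ring

theorem HasCorrelationLength.probGE_le_of_ncard_le (hcorr : HasCorrelationLength ω ξ C)
    (hω : IsState ω) (hξ : 0 < ξ) (hC : 0 ≤ C) (hk : 0 < k) (hH : H.IsHermitian)
    (hloc : 0 < localNorm k H) (hl : 0 ≤ l) (hM₁ : 1 ≤ M)
    (hM : ∀ v : V, (Metric.closedBall v l).ncard ≤ M) (ha : 0 < a)
    (hx : x = a * k / localNorm k H)
    (hscale : Fintype.card V / (k * M ^ 2) * (k * sStar x + rateF x) ≤ l / ξ) :
    probGE ω hH ((expect ω H).re + Fintype.card V * a) ≤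
      (C + 1) * Real.exp (-(Fintype.card V * (rateF x / (k ^ 2 * M ^ 2)))) := by
  have hk₁ : (1 : ℝ) ≤ k := mod_cast hk
  have : 0 < M := zero_lt_one.trans_le hM₁
  have hx₀ : 0 < x := by rw [hx]; positivity
  have hs : 0 < sStar x := (sStar_spec hx₀).1
  have hF : 0 < rateF x := rateF_pos hx₀
  have hfar : Fintype.card V * (sStar x / (k * M ^ 2)) +
      Fintype.card V * (rateF x / (k ^ 2 * M ^ 2)) ≤ l / ξ :=
    calc Fintype.card V * (sStar x / (k * M ^ 2)) + Fintype.card V * (rateF x / (k ^ 2 * M ^ 2))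
        = Fintype.card V / (k * M ^ 2) * (sStar x + rateF x / k) := by field_simp
      _ ≤ Fintype.card V / (k * M ^ 2) * (k * sStar x + rateF x) := by
          gcongr
          · exact le_mul_of_one_le_left hs.le hk₁
          · exact div_le_self hF.le hk₁
      _ ≤ l / ξ := hscale
  have hbound := hω.probGE_le_of_tilt hl (by positivity)
    (hcorr.correlationsBounded hω hξ hC hl) hk hH hloc hM₁ hM ha.le hx hs.le
  rw [← rateF_eq_sub_starSeries hx₀, mul_assoc C, ← Real.exp_add] at hbound
  rw [add_comm C, add_mul, one_mul]
  refine hbound.trans (add_le_add_right (mul_le_mul_of_nonneg_left (Real.exp_le_exp.2 ?_) hC) _)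
  linarith

theorem HasCorrelationLength.probGE_le_of_ballGrowth [Nonempty V]
    (hcorr : HasCorrelationLength ω ξ C) (hω : IsState ω) (hξ : 0 < ξ) (hC : 0 ≤ C) (hk : 0 < k)
    (hH : H.IsHermitian) (hloc : 0 < localNorm k H) (hball : BallGrowth V A d r₀) (hl : 0 < l)
    (hr₀ : r₀ ≤ l) (ha : 0 < a) (hx : x = a * k / localNorm k H)
    (hscale : Fintype.card V * (ξ / (k * A ^ 2) * (k * sStar x + rateF x)) ≤ l ^ (2 * d + 1)) :
    probGE ω hH ((expect ω H).re + Fintype.card V * a) ≤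
      (C + 1) * Real.exp (-(Fintype.card V * (rateF x / (k ^ 2 * A ^ 2 * l ^ (2 * d))))) := by
  have hA : 0 < A := hball.constant_pos
  have hsq : (A * l ^ d) ^ 2 = A ^ 2 * l ^ (2 * d) := by
    rw [mul_pow, mul_comm 2 d, Real.rpow_mul hl.le, Real.rpow_two]
  rw [mul_assoc _ (A ^ 2), ← hsq]
  refine hcorr.probGE_le_of_ncard_le hω hξ hC hk hH hloc hl.le (hball.one_le_mul_rpow hr₀ hl.le)
    (fun v => hball v l hr₀) ha hx ?_
  rw [Real.rpow_add hl, Real.rpow_one] at hscale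
  rw [hsq, le_div_iff₀ hξ]
  refine le_of_mul_le_mul_left (hscale.trans_eq' ?_) (Real.rpow_pos_of_pos hl (2 * d))
  field_simp

theorem div_rpow_scale_rpow {n D e : ℝ} (hn : 0 < n) (hD : 0 < D) (he : e + 1 ≠ 0) :
    n / ((n * D) ^ (1 / (e + 1))) ^ e = n ^ (1 / (e + 1)) / D ^ (e / (e + 1)) := by
  have hexp : 1 / (e + 1) = 1 - e / (e + 1) := by field_simp; ring
  rw [← Real.rpow_mul (by positivity), one_div_mul_eq_div, Real.mul_rpow hn.le hD.le, hexp,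
    Real.rpow_sub hn, Real.rpow_one, div_div]

end Concentration

end SpinSystem

end

open SpinSystem in
theorem mainTheorem2_general {V : Type*} [Fintype V] [DecidableEq V] [MetricSpace V] {q : ℕ}
    (n : ℕ) (hn : n = Fintype.card V)
    (A d r₀ : ℝ) (hball : BallGrowth V A d r₀) (ω : Op V q) (hω : IsState ω)
    (ξ C : ℝ) (hξ : 0 < ξ) (hC : 0 ≤ C) (hcorr : HasCorrelationLength ω ξ C)
    (k : ℕ) (H : Op V q) (hH : H.IsHermitian) (hloc : 0 < localNorm k H)
    (a : ℝ) (ha : 0 < a) (x D : ℝ) (hx : x = a * k / localNorm k H)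
    (hD : D = ξ / (k * A ^ 2) * (k * sStar x + rateF x)) :
    (r₀ ≤ (n * D) ^ (1 / (2 * d + 1)) →
      probGE ω hH ((expect ω H).re + n * a) ≤
        (C + 1) * Real.exp (-((n : ℝ) ^ (1 / (2 * d + 1)) *
          (rateF x / ((k : ℝ) ^ 2 * A ^ 2 * D ^ (2 * d / (2 * d + 1))))))) ∧
    ((n * D) ^ (1 / (2 * d + 1)) < r₀ →
      probGE ω hH ((expect ω H).re + n * a) ≤
        (C + 1) * Real.exp (-(n * (rateF x / ((k : ℝ) ^ 2 * A ^ 2 * r₀ ^ (2 * d)))))) := by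
  obtain ⟨Λ, ⟨v, hv⟩, hcard⟩ := nonempty_region_of_localNorm_pos hloc
  have : Nonempty V := ⟨v⟩
  have hk : 0 < k := (Finset.card_pos.2 ⟨v, hv⟩).trans_le hcard
  have hn₀ : (0 : ℝ) < n := by rw [hn]; exact mod_cast Fintype.card_pos
  have hA : 0 < A := hball.constant_pos
  have hd : 0 ≤ d := hball.exponent_nonneg
  have hx₀ : 0 < x := by rw [hx]; positivity
  have hD₀ : 0 < D := by
    rw [hD]
    have := (sStar_spec hx₀).1
    have := rateF_pos hx₀
    positivity
  have hl : 0 < (n * D) ^ (1 / (2 * d + 1)) := by positivity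
  have hscale : n * D = ((n * D) ^ (1 / (2 * d + 1))) ^ (2 * d + 1) := by
    rw [one_div, Real.rpow_inv_rpow (by positivity) (by positivity)]
  have hbound {r : ℝ} (hr : 0 < r) (hr₀ : r₀ ≤ r) (hnD : n * D ≤ r ^ (2 * d + 1)) :=
    hcorr.probGE_le_of_ballGrowth hω hξ hC hk hH hloc hball hr hr₀ ha hx (hn ▸ hD ▸ hnD)
  rw [← hn] at hbound
  refine ⟨fun hr₀ => (hbound hl hr₀ hscale.le).trans_eq ?_,
    fun hr₀ => hbound (hl.trans hr₀) le_rfl (hscale.trans_le (by gcongr))⟩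
  have hrate := div_rpow_scale_rpow hn₀ hD₀ (e := 2 * d) (by positivity)
  congr 3
  linear_combination rateF x / (k ^ 2 * A ^ 2) * hrate

open SpinSystem in
theorem mainTheorem2 {V : Type*} [Fintype V] [DecidableEq V] [MetricSpace V] {q : ℕ}
    (n : ℕ) (hn : n = Fintype.card V)
    (A d r₀ : ℝ) (hA : 0 < A) (hd : 1 ≤ d) (hr₀ : 0 < r₀) (hball : BallGrowth V A d r₀)
    (ω : Op V q) (hω : IsState ω)
    (ξ C : ℝ) (hξ : 0 < ξ) (hC : 0 < C) (hcorr : HasCorrelationLength ω ξ C)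
    (k : ℕ) (H : Op V q) (hH : H.IsHermitian) (hk : IsKLocal k H) (hloc : 0 < localNorm k H)
    (a : ℝ) (ha : 0 < a) (x D : ℝ) (hx : x = a * k / localNorm k H)
    (hD : D = ξ / (k * A ^ 2) * (k * sStar x + rateF x)) :
    (r₀ ≤ (n * D) ^ (1 / (2 * d + 1)) →
      probGE ω hH ((expect ω H).re + n * a) ≤
        (C + 1) * Real.exp (-((n : ℝ) ^ (1 / (2 * d + 1)) *
          (rateF x / ((k : ℝ) ^ 2 * A ^ 2 * D ^ (2 * d / (2 * d + 1))))))) ∧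
    ((n * D) ^ (1 / (2 * d + 1)) < r₀ →
      probGE ω hH ((expect ω H).re + n * a) ≤
        (C + 1) * Real.exp (-(n * (rateF x / ((k : ℝ) ^ 2 * A ^ 2 * r₀ ^ (2 * d)))))) :=
  mainTheorem2_general n hn A d r₀ hball ω hω ξ C hξ hC.le hcorr k H hH hloc a ha x D hx hD
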